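/- Let $\Gamma$ be a finite quiver of type $A$, possibly disconnected: each connected component of $\Gamma$ is an orientation of a Dynkin diagram $A_n$, $n\ge 1$. Let $I$ be its vertex set and, for an arrow $h$, write $h'$ and $h''$ for its source and target. Let $\nu\in\mathbb N I$, let $V=\bigoplus_{i\in I}V_i$ be an $I$-graded complex vector space with $\dim V_i=\nu_i$, and let $E_V=\bigoplus_{h}\operatorname{Hom}(V_{h'},V_{h''})$ be the space of representations of $\Gamma$ in $V$. Let $Y_\nu$ be the set of sequences $y=(i_1^{(a_1)},\dots,i_m^{(a_m)})$ of vertices $i_l\in I$ with positive integer multiplicities $a_l$ such that $\sum_{l=1}^m a_l i_l=\nu$. For $y\in Y_\nu$ let $F_y$ be the variety of flags $0=V^0\subset V^1\subset\cdots\subset V^m=V$ of $I$-graded subspaces such that $V^r/V^{r-1}$ has graded dimension $a_r\cdot i_r$ for all $r$, let $\widetilde F_y$ be the variety of pairs $(x,\phi)\in E_V\times F_y$ such that $x(V^r)\subset V^r$ for all $r$, and let $\pi_y\colon\widetilde F_y\to E_V$, $(x,\phi)\mapsto x$. Then for every $y\in Y_\nu$ and every $x\in E_V$ the fibre $\pi_y^{-1}(x)$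 (a complex variety with its reduced structure) is either empty or has a decomposition into affine cells, that is, there is a finite filtration $\emptyset=Z_0\subset Z_1\subset\cdots\subset Z_n=\pi_y^{-1}(x)$ by closed subvarieties such that each difference $Z_{r}\setminus Z_{r-1}$ is isomorphic to an affine space $\mathbb A^{d_r}$. -/

import Mathlib

open scoped Topology
open Filter

universe u v w

/-! ### Classical complex varieties as spaces with functions -/

/-- A space with functions over `ℂ`: a topological space with a sheaf of algebras of
`ℂ`-valued functions, called regular.  The sheaf is recorded through its germs:
`IsRegularAt x f` says that `f` restricts to a regular function on some open neighbourhood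
of `x` (the values of `f` away from `x` are irrelevant).  Classical varieties (with their closed
points, Zariski topology and regular functions) are spaces with functions. -/
structure SpaceWithFunctions (X : Type*) where
  top : TopologicalSpace X
  IsRegularAt : X → (X → ℂ) → Prop
  congr : ∀ (x : X) (f g : X → ℂ), f =ᶠ[@nhds X top x] g → IsRegularAt x f → IsRegularAt x g
  eventually : ∀ (x : X) (f : X → ℂ),
    IsRegularAt x f → ∀ᶠ z in @nhds X top x, IsRegularAt z f
  const : ∀ (x : X) (c : ℂ), IsRegularAt x (fun _ => c)
  add : ∀ (x : X) (f g : X → ℂ), IsRegularAt x f → IsRegularAt x g → IsRegularAt x (f + g)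
  mul : ∀ (x : X) (f g : X → ℂ), IsRegularAt x f → IsRegularAt x g → IsRegularAt x (f * g)
  ne_zero : ∀ (x : X) (f : X → ℂ),
    IsRegularAt x f → f x ≠ 0 → ∀ᶠ z in @nhds X top x, f z ≠ 0
  inv : ∀ (x : X) (f : X → ℂ), IsRegularAt x f → f x ≠ 0 → IsRegularAt x f⁻¹

/-- The polynomial functions on a complex vector space: the algebra of functions
generated by the linear forms. -/
def polyFunctions (E : Type*) [AddCommGroup E] [Module ℂ E] : Subalgebra ℂ (E → ℂ) :=
  Algebra.adjoin ℂ {f | ∃ l : Module.Dual ℂ E, f = fun v => l v}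

/-- The Zariski topology of a vector space, with basis the sets `{p ≠ 0}`, `p` polynomial. -/
@[reducible] def zariskiTopology (E : Type*) [AddCommGroup E] [Module ℂ E] : TopologicalSpace E :=
  TopologicalSpace.generateFrom {U | ∃ p ∈ polyFunctions E, U = {v | p v ≠ 0}}

theorem zariski_eventually_ne {E : Type*} [AddCommGroup E] [Module ℂ E] {p : E → ℂ}
    (hp : p ∈ polyFunctions E) {x : E} (hx : p x ≠ 0) :
    ∀ᶠ z in @nhds E (zariskiTopology E) x, p z ≠ 0 := by
  let := zariskiTopology E
  exact IsOpen.mem_nhds (TopologicalSpace.isOpen_generateFrom_of_mem ⟨p, hp, rfl⟩) hx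

namespace SpaceWithFunctions

/-- A finite-dimensional vector space as an affine space: the regular functions are those which
are locally quotients of polynomials. -/
def affine (E : Type*) [AddCommGroup E] [Module ℂ E] : SpaceWithFunctions E where
  top := zariskiTopology E
  IsRegularAt x f := ∃ p ∈ polyFunctions E, ∃ q ∈ polyFunctions E,
    q x ≠ 0 ∧ f =ᶠ[@nhds E (zariskiTopology E) x] fun v => p v / q v
  congr := by
    rintro x f g h ⟨p, hp, q, hq, hx, hf⟩
    exact ⟨p, hp, q, hq, hx, h.symm.trans hf⟩
  eventually := by
    rintro x f ⟨p, hp, q, hq, hx, hf⟩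
    let := zariskiTopology E
    filter_upwards [zariski_eventually_ne hq hx, hf.eventually_nhds] with z hz hz'
    exact ⟨p, hp, q, hq, hz, hz'⟩
  const x c := ⟨algebraMap ℂ (E → ℂ) c, Subalgebra.algebraMap_mem _ c, 1, one_mem _,
    one_ne_zero, Filter.Eventually.of_forall fun v => by simp⟩
  add := by
    rintro x f g ⟨p, hp, q, hq, hx, hf⟩ ⟨p', hp', q', hq', hx', hf'⟩
    refine ⟨p * q' + q * p', add_mem (mul_mem hp hq') (mul_mem hq hp'), q * q', mul_mem hq hq',
      mul_ne_zero hx hx', ?_⟩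
    filter_upwards [hf, hf', zariski_eventually_ne hq hx, zariski_eventually_ne hq' hx']
      with z h h' h1 h2
    simp only [Pi.add_apply, Pi.mul_apply, h, h']
    exact div_add_div _ _ h1 h2
  mul := by
    rintro x f g ⟨p, hp, q, hq, hx, hf⟩ ⟨p', hp', q', hq', hx', hf'⟩
    refine ⟨p * p', mul_mem hp hp', q * q', mul_mem hq hq', mul_ne_zero hx hx', ?_⟩
    filter_upwards [hf, hf'] with z h h'
    simp only [Pi.mul_apply, h, h']
    exact div_mul_div_comm _ _ _ _
  ne_zero := by
    rintro x f ⟨p, hp, q, hq, hx, hf⟩ h0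
    let := zariskiTopology E
    have hpx : p x ≠ 0 := by
      intro h
      apply h0
      simp [hf.self_of_nhds, h]
    filter_upwards [hf, zariski_eventually_ne hq hx, zariski_eventually_ne hp hpx] with z h h1 h2
    rw [h]
    exact div_ne_zero h2 h1
  inv := by
    rintro x f ⟨p, hp, q, hq, hx, hf⟩ h0
    let := zariskiTopology E
    have hpx : p x ≠ 0 := by
      intro h
      apply h0
      simp [hf.self_of_nhds, h]
    refine ⟨q, hq, p, hp, hpx, ?_⟩
    filter_upwards [hf] with z h
    simp only [Pi.inv_apply, h, inv_div]

/-- The structure induced on `Y` by an injective map `i : Y → X`: the induced topology, the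
regular functions being locally the restrictions of regular functions.  On a locally closed
subset of a variety this is the reduced subvariety structure. -/
def induced {X Y : Type*} (S : SpaceWithFunctions X) (i : Y → X) : SpaceWithFunctions Y where
  top := S.top.induced i
  IsRegularAt y f := ∃ F : X → ℂ, S.IsRegularAt (i y) F ∧
    f =ᶠ[@nhds Y (S.top.induced i) y] F ∘ i
  congr := by
    rintro x f g h ⟨F, hF, hf⟩
    exact ⟨F, hF, h.symm.trans hf⟩
  eventually := by
    rintro x f ⟨F, hF, hf⟩
    let := S.top
    let := S.top.induced i
    have hc : Tendsto i (𝓝 x) (𝓝 (i x)) := (continuous_induced_dom (f := i)).continuousAt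
    filter_upwards [hc.eventually (S.eventually _ _ hF), hf.eventually_nhds] with z h h'
    exact ⟨F, h, h'⟩
  const x c := ⟨fun _ => c, S.const _ c, Filter.EventuallyEq.rfl⟩
  add := by
    rintro x f g ⟨F, hF, hf⟩ ⟨G, hG, hg⟩
    exact ⟨F + G, S.add _ _ _ hF hG, hf.add hg⟩
  mul := by
    rintro x f g ⟨F, hF, hf⟩ ⟨G, hG, hg⟩
    exact ⟨F * G, S.mul _ _ _ hF hG, hf.mul hg⟩
  ne_zero := by
    rintro x f ⟨F, hF, hf⟩ h0
    let := S.top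
    let := S.top.induced i
    have hc : Tendsto i (𝓝 x) (𝓝 (i x)) := (continuous_induced_dom (f := i)).continuousAt
    have hx : F (i x) ≠ 0 := by rwa [hf.self_of_nhds] at h0
    filter_upwards [hf, hc.eventually (S.ne_zero _ _ hF hx)] with z h h'
    rwa [h]
  inv := by
    rintro x f ⟨F, hF, hf⟩ h0
    let := S.top
    let := S.top.induced i
    have hx : F (i x) ≠ 0 := by rwa [hf.self_of_nhds] at h0
    exact ⟨F⁻¹, S.inv _ _ hF hx, hf.inv⟩

/-- The reduced structure on a subset. -/
def restrict {X : Type*} (S : SpaceWithFunctions X) (Z : Set X) : SpaceWithFunctions Z :=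
  S.induced Subtype.val

/-- The quotient structure along a surjective map `q : X → Y`: the quotient topology, a function on
an open subset of `Y` being regular if its composition with `q` is regular. -/
def quotient {X Y : Type*} (S : SpaceWithFunctions X) (q : X → Y) : SpaceWithFunctions Y where
  top := S.top.coinduced q
  IsRegularAt y f := ∃ U : Set Y, @IsOpen Y (S.top.coinduced q) U ∧ y ∈ U ∧
    ∀ x, q x ∈ U → S.IsRegularAt x (f ∘ q)
  congr := by
    rintro y f g h ⟨U, hU, hy, hf⟩
    let := S.top
    let := S.top.coinduced q
    obtain ⟨W, hW, hWo, hyW⟩ := mem_nhds_iff.1 h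
    refine ⟨U ∩ W, hU.inter hWo, ⟨hy, hyW⟩, fun x hx => ?_⟩
    refine S.congr x _ _ ?_ (hf x hx.1)
    have hc : Tendsto q (𝓝 x) (𝓝 (q x)) := (continuous_coinduced_rng (f := q)).continuousAt
    exact hc.eventually (Filter.mem_of_superset (hWo.mem_nhds hx.2) hW)
  eventually := by
    rintro y f ⟨U, hU, hy, hf⟩
    let := S.top.coinduced q
    filter_upwards [hU.mem_nhds hy] with z hz
    exact ⟨U, hU, hz, hf⟩
  const y c := ⟨Set.univ, @isOpen_univ _ (S.top.coinduced q), trivial, fun x _ => S.const x c⟩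
  add := by
    rintro y f g ⟨U, hU, hy, hf⟩ ⟨W, hW, hy', hg⟩
    exact ⟨U ∩ W, @IsOpen.inter Y (S.top.coinduced q) U W hU hW, ⟨hy, hy'⟩,
      fun x hx => S.add _ _ _ (hf x hx.1) (hg x hx.2)⟩
  mul := by
    rintro y f g ⟨U, hU, hy, hf⟩ ⟨W, hW, hy', hg⟩
    exact ⟨U ∩ W, @IsOpen.inter Y (S.top.coinduced q) U W hU hW, ⟨hy, hy'⟩,
      fun x hx => S.mul _ _ _ (hf x hx.1) (hg x hx.2)⟩
  ne_zero := by
    rintro y f ⟨U, hU, hy, hf⟩ h0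
    let := S.top
    let := S.top.coinduced q
    have hUo : IsOpen {z | z ∈ U ∧ f z ≠ 0} := by
      rw [isOpen_coinduced, isOpen_iff_mem_nhds]
      rintro x ⟨hx, hx0⟩
      exact Filter.inter_mem ((isOpen_coinduced.1 hU).mem_nhds hx)
        (S.ne_zero x _ (hf x hx) hx0)
    filter_upwards [hUo.mem_nhds ⟨hy, h0⟩] with z hz using hz.2
  inv := by
    rintro y f ⟨U, hU, hy, hf⟩ h0
    let := S.top
    let := S.top.coinduced q
    have hUo : IsOpen {z | z ∈ U ∧ f z ≠ 0} := by
      rw [isOpen_coinduced, isOpen_iff_mem_nhds]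
      rintro x ⟨hx, hx0⟩
      exact Filter.inter_mem ((isOpen_coinduced.1 hU).mem_nhds hx)
        (S.ne_zero x _ (hf x hx) hx0)
    exact ⟨_, hUo, ⟨hy, h0⟩, fun x hx => S.inv x _ (hf x hx.1) hx.2⟩

/-- An isomorphism: a homeomorphism which matches the regular functions on both sides. -/
structure Iso {X Y : Type*} (S : SpaceWithFunctions X) (T : SpaceWithFunctions Y) where
  toEquiv : X ≃ Y
  isOpen_iff : ∀ U : Set Y, @IsOpen X S.top (toEquiv ⁻¹' U) ↔ @IsOpen Y T.top U
  isRegularAt_iff : ∀ (x : X) (f : Y → ℂ),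
    S.IsRegularAt x (f ∘ toEquiv) ↔ T.IsRegularAt (toEquiv x) f

/-- A decomposition into affine cells (an affine paving): a finite filtration
`∅ = Z 0 ⊆ Z 1 ⊆ ⋯ ⊆ Z n = X` by closed subsets such that each difference
`Z (r + 1) \ Z r` is isomorphic to an affine space `𝔸^d`. -/
def HasAffineCellDecomposition {X : Type*} (S : SpaceWithFunctions X) : Prop :=
  ∃ (n : ℕ) (Z : Fin (n + 1) → Set X),
    Z 0 = ∅ ∧ Z (Fin.last n) = Set.univ ∧
    (∀ r, @IsClosed X S.top (Z r)) ∧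
    ∀ r : Fin n, Z r.castSucc ⊆ Z r.succ ∧
      ∃ d : ℕ, Nonempty (Iso (S.restrict (Z r.succ \ Z r.castSucc)) (affine (Fin d → ℂ)))

end SpaceWithFunctions

/-! ### Products of Grassmannians -/

/-- The Grassmannian of `k`-dimensional subspaces. -/
abbrev Grass (W : Type*) [AddCommGroup W] [Module ℂ W] (k : ℕ) : Type _ :=
  {U : Submodule ℂ W // Module.finrank ℂ U = k}

section Grassmannians

variable (E : Type*) [AddCommGroup E] [Module ℂ E] {J : Type*} (W : J → Type*)
  [∀ j, AddCommGroup (W j)] [∀ j, Module ℂ (W j)] (k : J → ℕ)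

/-- Pairs of a vector of `E` and of a family of frames (linearly independent `k j`-tuples) in the
spaces `W j`; a Zariski open subset of a vector space. -/
abbrev framedSet : Set (E × (∀ j, Fin (k j) → W j)) :=
  {p | ∀ j, LinearIndependent ℂ (p.2 j)}

/-- The map sending a frame to its span. -/
def framedMap (p : framedSet E W k) : E × (∀ j, Grass (W j) (k j)) :=
  (p.1.1, fun j => ⟨Submodule.span ℂ (Set.range (p.1.2 j)), by
    rw [finrank_span_eq_card (p.2 j), Fintype.card_fin]⟩)

/-- The variety `E × ∏ j, Gr (k j) (W j)`: each Grassmannian is the quotient of the open variety of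
`k`-frames by the change of frame. -/
def grassmannianProduct : SpaceWithFunctions (E × (∀ j, Grass (W j) (k j))) :=
  ((SpaceWithFunctions.affine (E × (∀ j, Fin (k j) → W j))).restrict
    (framedSet E W k)).quotient (framedMap E W k)

end Grassmannians

/-! ### Quivers of type A -/

/-- A quiver is of type `A` if each of its connected components is an orientation of a Dynkin
diagram `A_n`, `n ≥ 1`: its vertices can be numbered `0, …, n - 1` so that there is exactly one
arrow, in one of the two directions, between consecutive vertices, and no other arrow. -/
def IsQuiverOfTypeA (I : Type*) [Quiver I] : Prop :=
  ∀ c : Quiver.WeaklyConnectedComponent I,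
    ∃ (n : ℕ) (_ : 1 ≤ n)
      (e : Fin n ≃ {i : I // (i : Quiver.WeaklyConnectedComponent I) = c}),
      ∀ a b : Fin n,
        (a.val + 1 = b.val →
          Nonempty (Unique (((e a).1 ⟶ (e b).1) ⊕ ((e b).1 ⟶ (e a).1)))) ∧
        (a.val + 1 ≠ b.val → b.val + 1 ≠ a.val → IsEmpty ((e a).1 ⟶ (e b).1))

/-! ### Lusztig's varieties of flags -/

section Lusztig



open Classical in
/-- The set `Y_ν` of sequences `y = (i_1^{(a_1)}, …, i_m^{(a_m)})` of vertices with positive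
multiplicities such that `∑ l, a_l i_l = ν`. -/
structure FlagType {I : Type*} (ν : I → ℕ) where
  length : ℕ
  vertex : Fin length → I
  mult : Fin length → ℕ
  mult_pos : ∀ l, 0 < mult l
  sum_eq : ∀ i, (∑ l, if vertex l = i then mult l else 0) = ν i

open Classical in
/-- The dimension at the vertex `i` of the `r`-th step of a flag of type `y`. -/
noncomputable def FlagType.stepDim {I : Type*} {ν : I → ℕ} (y : FlagType ν)
    (r : Fin (y.length + 1)) (i : I) : ℕ :=
  ∑ l : Fin y.length, if l.castSucc < r ∧ y.vertex l = i then y.mult l else 0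

variable {I : Type*} (V : I → Type*) [∀ i, AddCommGroup (V i)] [∀ i, Module ℂ (V i)]

/-- The space `E_V` of representations of the quiver in `V`. -/
abbrev QuiverRep [Quiver.{v + 1} I] : Type _ :=
  ∀ i j : I, (i ⟶ j) → (V i →ₗ[ℂ] V j)

open Classical in
/-- The set `F_y` of flags `0 = V^0 ⊆ V^1 ⊆ ⋯ ⊆ V^m = V` of graded subspaces such that
`V^r / V^{r-1}` has graded dimension `a_r i_r`. -/
@[ext] structure GradedFlag {ν : I → ℕ} (y : FlagType ν) where
  sub : Fin (y.length + 1) → ∀ i, Submodule ℂ (V i)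
  sub_zero : ∀ i, sub 0 i = ⊥
  sub_last : ∀ i, sub (Fin.last _) i = ⊤
  mono : ∀ (r : Fin y.length) (i : I), sub r.castSucc i ≤ sub r.succ i
  finrank_quotient : ∀ (r : Fin y.length) (i : I),
    Module.finrank ℂ (sub r.succ i ⧸ (sub r.castSucc i).submoduleOf (sub r.succ i)) =
      if y.vertex r = i then y.mult r else 0

variable {V}

theorem GradedFlag.finrank_sub [∀ i, FiniteDimensional ℂ (V i)] {ν : I → ℕ} {y : FlagType ν}
    (φ : GradedFlag V y) (r : Fin (y.length + 1)) (i : I) :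
    Module.finrank ℂ (φ.sub r i) = y.stepDim r i := by
  classical
  induction r using Fin.induction with
  | zero => simp [FlagType.stepDim, φ.sub_zero]
  | succ r ih =>
    have h1 := Submodule.finrank_quotient_add_finrank
      ((φ.sub r.castSucc i).submoduleOf (φ.sub r.succ i))
    rw [φ.finrank_quotient r i, (Submodule.submoduleOfEquivOfLe (φ.mono r i)).finrank_eq, ih] at h1
    rw [← h1]
    unfold FlagType.stepDim
    have h2 : (if y.vertex r = i then y.mult r else 0) =
        ∑ l, if l = r then (if y.vertex l = i then y.mult l else 0) else 0 := by simp
    rw [h2, ← Finset.sum_add_distrib]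
    refine Finset.sum_congr rfl fun l _ => ?_
    rcases lt_trichotomy l r with h | h | h
    · have h3 : l < r := h
      simp [h.ne, Fin.castSucc_lt_succ_iff, h3, h3.le]
    · subst h
      simp
    · simp [h.ne', Fin.castSucc_lt_succ_iff, h.not_ge, h.not_gt]

variable (V)

/-- The set `F̃_y` of pairs `(x, φ)` in `E_V × F_y` such that `x(V^r) ⊆ V^r` for all `r`. -/
def LusztigVariety [Quiver.{v + 1} I] {ν : I → ℕ} (y : FlagType ν) : Type _ :=
  {p : QuiverRep V × GradedFlag V y //
    ∀ (r : Fin (y.length + 1)) (i j : I) (h : i ⟶ j),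
      (p.2.sub r i).map (p.1 i j h) ≤ p.2.sub r j}

/-- The embedding of `F̃_y` in the product of `E_V` with the Grassmannians of the subspaces
`V^r_i ⊆ V_i`. -/
def lusztigEmbedding [Quiver.{v + 1} I] [∀ i, FiniteDimensional ℂ (V i)] {ν : I → ℕ}
    (y : FlagType ν) (p : LusztigVariety V y) :
    QuiverRep V × (∀ j : Fin (y.length + 1) × I, Grass (V j.2) (y.stepDim j.1 j.2)) :=
  (p.1.1, fun j => ⟨p.1.2.sub j.1 j.2, p.1.2.finrank_sub j.1 j.2⟩)

/-- The variety `F̃_y`, closed in the product of `E_V` with Grassmannians. -/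
noncomputable def lusztigVariety [Quiver.{v + 1} I] [∀ i, FiniteDimensional ℂ (V i)]
    {ν : I → ℕ} (y : FlagType ν) : SpaceWithFunctions (LusztigVariety V y) :=
  (grassmannianProduct (QuiverRep V) (fun j : Fin (y.length + 1) × I => V j.2)
    (fun j => y.stepDim j.1 j.2)).induced (lusztigEmbedding V y)

/-- The projection `π_y : F̃_y → E_V`. -/
def lusztigMap [Quiver.{v + 1} I] {ν : I → ℕ} (y : FlagType ν) (p : LusztigVariety V y) :
    QuiverRep V := p.1.1

/-- The fibre `π_y⁻¹(x)`. -/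
def lusztigFibre [Quiver.{v + 1} I] {ν : I → ℕ} (y : FlagType ν) (x : QuiverRep V) :
    Set (LusztigVariety V y) := lusztigMap V y ⁻¹' {x}

end Lusztig

/-!
The fibre `π_y⁻¹(x)` consists of the flags of type `y` preserved by the representation `x`.  It is
cut into strata by the relative position with respect to well-chosen bases of the spaces `V i`, and
each stratum is an affine space.

*Bases.*  The vertices of each component are placed on a line (`IsLinePosition`).  Since the quiver
is of type A, the representation splits into summands with spaces of dimension at most one.  In
terms of bases: each `V i` has a basis labelled by a finite set `K i` of integers, such that an
arrow sends a basis vector to the one with the same label, if there is one, and otherwise to zero.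
The labels are moreover ordered in such a way that those appearing when an arrow is crossed from left to
right are larger than the old ones for an arrow to the right, and smaller for an arrow to the left
(`AdaptedBases`, `nonempty_adaptedBases`).  To find these bases, labelled complete flags are
propagated from left to right by images and preimages, and then bases adapted to them are chosen
from right to left.

*Strata.*  The dimensions of the intersections of the steps of a flag with the coordinate subspaces
of these bases determine the pivots of the steps.  If the pivots are fixed, a family of flags is
described by its reduced echelon forms, that is, by one unitriangular matrix `u i` at each vertex,
with prescribed zeros (`exists_unitriangular_of_pivots`).  An arrow from `i` to `j` with matrix `X`
preserves the flags if and only if the entries `(q, p)` of `(u j)⁻¹ * X * u i` in certain positions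
vanish (`mapsTo_columnSpan_iff`).  The leading part of such an equation is linear in the entries
`(q, p)` of `u i` and `u j`, and by the order of the labels the entry at the left end of the arrow
occurs in it; as there is at most one arrow to the right of each vertex, the system is triangular,
each equation determining its own unknown as a polynomial in unknowns of smaller length `p - q`, or
of the same length further to the right (`arrowMatrix_sub_congr_source`,
`arrowMatrix_add_congr_target`).  So the solutions are parametrized by the values of the free
unknowns (`exists_parametrization`).  This parametrization lifts to a polynomial map to frames, and
its inverse is given by coordinates of charts of Grassmannians (`isRegularAt_chartCoord`); hence the
stratum is isomorphic to an affine space (`exists_iso_stratum`).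

*Closedness.*  The dimensions which define the strata are upper semicontinuous
(`eventually_finrank_inf_le`), so that the strata, listed by decreasing sum of these dimensions,
form an affine cell decomposition (`hasAffineCellDecomposition_of_semicontinuous`).
-/

/-! ### Morphisms of spaces with functions -/

namespace SpaceWithFunctions

variable {X Y Z : Type*}

/-- A morphism of spaces with functions: a continuous map such that the composition of a regular
function with it is regular. -/
structure IsMorphism (S : SpaceWithFunctions X) (T : SpaceWithFunctions Y) (f : X → Y) : Prop where
  isOpen_preimage : ∀ U : Set Y, IsOpen[T.top] U → IsOpen[S.top] (f ⁻¹' U)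
  isRegularAt_comp : ∀ x g, T.IsRegularAt (f x) g → S.IsRegularAt x (g ∘ f)

theorem IsMorphism.comp {S : SpaceWithFunctions X} {T : SpaceWithFunctions Y}
    {R : SpaceWithFunctions Z} {f : X → Y} {g : Y → Z} (hg : IsMorphism T R g)
    (hf : IsMorphism S T f) : IsMorphism S R (g ∘ f) :=
  ⟨fun U hU => hf.1 _ (hg.1 U hU), fun x k hk => hf.2 x _ (hg.2 (f x) k hk)⟩

theorem IsMorphism.eventually {S : SpaceWithFunctions X} {T : SpaceWithFunctions Y} {f : X → Y}
    (hf : IsMorphism S T f) {x : X} {P : Y → Prop} (h : ∀ᶠ b in @nhds Y T.top (f x), P b) :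
    ∀ᶠ a in @nhds X S.top x, P (f a) := by
  obtain ⟨W, hW, hO, hxW⟩ := (@eventually_nhds_iff _ T.top _ _).1 h
  exact (@eventually_nhds_iff _ S.top _ _).2 ⟨_, fun a ha => hW _ ha, hf.1 W hO, hxW⟩

theorem isMorphism_induced (S : SpaceWithFunctions X) (i : Y → X) :
    IsMorphism (S.induced i) S i :=
  ⟨fun U hU => ⟨U, hU, rfl⟩, fun _ g hg => ⟨g, hg, Filter.EventuallyEq.rfl⟩⟩

theorem IsMorphism.to_induced {S : SpaceWithFunctions X} {T : SpaceWithFunctions Z} {i : Y → X}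
    {f : Z → Y} (h : IsMorphism T S (i ∘ f)) : IsMorphism T (S.induced i) f := by
  constructor
  · rintro _ ⟨W, hW, rfl⟩
    exact h.1 W hW
  · rintro z g ⟨F, hF, hg⟩
    refine T.congr z _ _ ?_ (h.2 z F hF)
    obtain ⟨_, hW, ⟨O, hO, rfl⟩, hzW⟩ := (@eventually_nhds_iff _ (S.top.induced i) _ _).1 hg
    refine (@eventually_nhds_iff _ T.top _ _).2 ⟨_, fun a ha => ?_, h.1 O hO, hzW⟩
    exact (hW _ ha).symm

theorem isMorphism_quotient (S : SpaceWithFunctions X) (q : X → Y) :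
    IsMorphism S (S.quotient q) q :=
  ⟨fun _ hU => hU, fun x _ ⟨_, _, hx, hg⟩ => hg x hx⟩

/-- A bijection which is a morphism in both directions is an isomorphism. -/
def Iso.ofIsMorphism {S : SpaceWithFunctions X} {T : SpaceWithFunctions Y} (e : X ≃ Y)
    (h : IsMorphism S T e) (h' : IsMorphism T S e.symm) : Iso S T where
  toEquiv := e
  isOpen_iff U := by
    refine ⟨fun hU => ?_, h.1 U⟩
    have := h'.1 _ hU
    rwa [← Set.preimage_comp, e.self_comp_symm, Set.preimage_id] at this
  isRegularAt_iff x f := by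
    refine ⟨fun hf => ?_, h.2 x f⟩
    have := h'.2 (e x) (f ∘ e) (by rwa [e.symm_apply_apply])
    rwa [Function.comp_assoc, e.self_comp_symm, Function.comp_id] at this

theorem isRegularAt_affine {E : Type*} [AddCommGroup E] [Module ℂ E] {p : E → ℂ}
    (hp : p ∈ polyFunctions E) (x : E) : (affine E).IsRegularAt x p :=
  ⟨p, hp, 1, one_mem _, one_ne_zero, Filter.Eventually.of_forall fun v => by simp⟩

/-- Functions of the form `p / q`, with polynomials `p` and `q`, are regular where `q ≠ 0`. -/
theorem isRegularAt_affine_div {E : Type*} [AddCommGroup E] [Module ℂ E] {p q : E → ℂ}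
    (hp : p ∈ polyFunctions E) (hq : q ∈ polyFunctions E) {x : E} (hx : q x ≠ 0) :
    (affine E).IsRegularAt x (fun v => p v / q v) :=
  ⟨p, hp, q, hq, hx, Filter.EventuallyEq.rfl⟩

theorem isRegularAt_poly_comp (S : SpaceWithFunctions X) {E : Type*} [AddCommGroup E]
    [Module ℂ E] {f : X → E} {x : X}
    (h : ∀ l : Module.Dual ℂ E, S.IsRegularAt x (fun a => l (f a)))
    {p : E → ℂ} (hp : p ∈ polyFunctions E) : S.IsRegularAt x (p ∘ f) := by
  induction hp using Algebra.adjoin_induction with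
  | mem p hp =>
    obtain ⟨l, rfl⟩ := hp
    exact h l
  | algebraMap c => exact S.const x c
  | add p q _ _ hp hq => exact S.add _ _ _ hp hq
  | mul p q _ _ hp hq => exact S.mul _ _ _ hp hq

/-- A map to a vector space is a morphism as soon as its coordinates are regular. -/
theorem isMorphism_affine (S : SpaceWithFunctions X) {E : Type*} [AddCommGroup E]
    [Module ℂ E] {f : X → E}
    (h : ∀ (l : Module.Dual ℂ E) (x : X), S.IsRegularAt x (fun a => l (f a))) :
    IsMorphism S (affine E) f := by
  have hp : ∀ {p : E → ℂ}, p ∈ polyFunctions E → ∀ x, S.IsRegularAt x (p ∘ f) :=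
    fun hp x => isRegularAt_poly_comp S (fun l => h l x) hp
  have hc : ∀ U : Set E, IsOpen[zariskiTopology E] U → IsOpen[S.top] (f ⁻¹' U) := by
    refine fun U hU => @Continuous.isOpen_preimage _ _ S.top (zariskiTopology E) f ?_ U hU
    refine (@continuous_generateFrom_iff _ _ f S.top _).2 ?_
    rintro _ ⟨p, hpp, rfl⟩
    let := S.top
    rw [isOpen_iff_mem_nhds]
    intro x hx
    exact S.ne_zero x _ (hp hpp x) hx
  refine ⟨hc, ?_⟩
  rintro x g ⟨p, hpp, q, hq, hx, hg⟩
  have h1 := S.mul x _ _ (hp hpp x) (S.inv x _ (hp hq x) hx)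
  refine S.congr x _ _ ?_ h1
  obtain ⟨W, hW, hO, hzW⟩ := (@eventually_nhds_iff _ (zariskiTopology E) _ _).1 hg
  refine (@eventually_nhds_iff _ S.top _ _).2 ⟨_, fun a ha => ?_, hc W hO, hzW⟩
  exact (hW _ ha).symm

end SpaceWithFunctions

/-! ### Polynomial maps between vector spaces -/

/-- A map between vector spaces is polynomial if its composition with each linear form is. -/
def IsPolyMap {E F : Type*} [AddCommGroup E] [Module ℂ E] [AddCommGroup F] [Module ℂ F]
    (f : E → F) : Prop :=
  ∀ l : Module.Dual ℂ F, (fun z => l (f z)) ∈ polyFunctions E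

section IsPolyMap

variable {E F : Type*} [AddCommGroup E] [Module ℂ E] [AddCommGroup F] [Module ℂ F]

theorem linear_mem_polyFunctions (l : Module.Dual ℂ E) : (fun z => l z) ∈ polyFunctions E :=
  Algebra.subset_adjoin ⟨l, rfl⟩

theorem coord_mem_polyFunctions {ι : Type*} (i : ι) :
    (fun z : ι → ℂ => z i) ∈ polyFunctions (ι → ℂ) :=
  linear_mem_polyFunctions (LinearMap.proj (R := ℂ) (φ := fun _ : ι => ℂ) i)

theorem const_mem_polyFunctions (c : ℂ) : (fun _ : E => c) ∈ polyFunctions E :=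
  Subalgebra.algebraMap_mem _ c

theorem sum_mem_polyFunctions {ι : Type*} (s : Finset ι) {f : ι → E → ℂ}
    (h : ∀ i ∈ s, f i ∈ polyFunctions E) : (fun z => ∑ i ∈ s, f i z) ∈ polyFunctions E := by
  have := Subalgebra.sum_mem (polyFunctions E) h
  convert this using 1
  ext z
  simp

theorem prod_mem_polyFunctions {ι : Type*} (s : Finset ι) {f : ι → E → ℂ}
    (h : ∀ i ∈ s, f i ∈ polyFunctions E) : (fun z => ∏ i ∈ s, f i z) ∈ polyFunctions E := by
  have := Subalgebra.prod_mem (polyFunctions E) h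
  convert this using 1
  ext z
  simp

theorem IsPolyMap.comp_mem {f : E → F} (hf : IsPolyMap f) {p : F → ℂ}
    (hp : p ∈ polyFunctions F) : (fun z => p (f z)) ∈ polyFunctions E := by
  induction hp using Algebra.adjoin_induction with
  | mem p hp =>
    obtain ⟨l, rfl⟩ := hp
    exact hf l
  | algebraMap c => exact const_mem_polyFunctions c
  | add p q _ _ hp hq => exact add_mem hp hq
  | mul p q _ _ hp hq => exact mul_mem hp hq

theorem isPolyMap_const (c : F) : IsPolyMap (fun _ : E => c) :=
  fun l => const_mem_polyFunctions (l c)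

theorem IsPolyMap.sum {ι : Type*} (s : Finset ι) {f : ι → E → F}
    (h : ∀ i ∈ s, IsPolyMap (f i)) : IsPolyMap (fun z => ∑ i ∈ s, f i z) := by
  intro l
  simp only [map_sum]
  exact sum_mem_polyFunctions s fun i hi => h i hi l

theorem isPolyMap_smul {f : E → ℂ} (hf : f ∈ polyFunctions E) (c : F) :
    IsPolyMap (fun z => f z • c) := by
  intro l
  simp only [map_smul, smul_eq_mul]
  exact mul_mem hf (const_mem_polyFunctions (l c))

theorem isPolyMap_pi {ι : Type*} [Finite ι] {G : ι → Type*} [∀ i, AddCommGroup (G i)]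
    [∀ i, Module ℂ (G i)] {f : E → ∀ i, G i} (h : ∀ i, IsPolyMap (fun z => f z i)) :
    IsPolyMap f := by
  classical
  have := Fintype.ofFinite ι
  intro l
  have h1 : (fun z => l (f z)) =
      fun z => ∑ i, (l ∘ₗ LinearMap.single ℂ G i) (f z i) := by
    ext z
    conv_lhs => rw [← LinearMap.sum_single_apply G (f z)]
    simp [map_sum]
  rw [h1]
  exact sum_mem_polyFunctions _ fun i _ => h i _

theorem isPolyMap_prodMk {G : Type*} [AddCommGroup G] [Module ℂ G] {f : E → F} {g : E → G}
    (hf : IsPolyMap f) (hg : IsPolyMap g) : IsPolyMap (fun z => (f z, g z)) := by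
  intro l
  have h1 : (fun z => l (f z, g z)) =
      fun z => (l ∘ₗ LinearMap.inl ℂ F G) (f z) + (l ∘ₗ LinearMap.inr ℂ F G) (g z) := by
    ext z
    simp [← map_add]
  rw [h1]
  exact add_mem (hf _) (hg _)

theorem det_mem_polyFunctions {n : Type*} [Fintype n] [DecidableEq n] {M : E → Matrix n n ℂ}
    (h : ∀ a b, (fun z => M z a b) ∈ polyFunctions E) :
    (fun z => (M z).det) ∈ polyFunctions E := by
  simp only [Matrix.det_apply']
  exact sum_mem_polyFunctions _ fun σ _ =>
    mul_mem (const_mem_polyFunctions _) (prod_mem_polyFunctions _ fun a _ => h _ _)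

theorem adjugate_mem_polyFunctions {n : Type*} [Fintype n] [DecidableEq n]
    {M : E → Matrix n n ℂ} (h : ∀ a b, (fun z => M z a b) ∈ polyFunctions E) (a b : n) :
    (fun z => (M z).adjugate a b) ∈ polyFunctions E := by
  simp only [Matrix.adjugate_apply]
  refine det_mem_polyFunctions fun c d => ?_
  by_cases hc : c = b
  · subst hc
    simpa using const_mem_polyFunctions _
  · simpa [Matrix.updateRow_ne hc] using h c d

theorem SpaceWithFunctions.isMorphism_of_isPolyMap {f : E → F} (hf : IsPolyMap f) :
    IsMorphism (affine E) (affine F) f :=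
  isMorphism_affine _ fun l x => isRegularAt_affine (hf l) x

end IsPolyMap

/-! ### Charts of products of Grassmannians -/

section GrassmannianCharts

variable {E : Type*} {J : Type*} {W : J → Type*}
  [∀ j, AddCommGroup (W j)] [∀ j, Module ℂ (W j)] {k : J → ℕ}

/-- The domain of a chart: the points whose `j`-th component is mapped injectively (hence
isomorphically) to `ℂ ^ k j` by a given linear map. -/
def chartDomain (E : Type*) (j : J) (l : W j →ₗ[ℂ] (Fin (k j) → ℂ)) :
    Set (E × (∀ j, Grass (W j) (k j))) :=
  {y | ∀ w ∈ (y.2 j).1, l w = 0 → w = 0}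

open Classical in
/-- The coordinates of a chart: the value of a linear form `f` at the unique vector of the `j`-th
subspace whose image under `l` is the vector `a`. -/
noncomputable def chartCoord (E : Type*) (j : J) (l : W j →ₗ[ℂ] (Fin (k j) → ℂ)) (a : Fin (k j) → ℂ)
    (f : Module.Dual ℂ (W j)) (y : E × (∀ j, Grass (W j) (k j))) : ℂ :=
  if h : ∃ w ∈ (y.2 j).1, l w = a then f h.choose else 0

theorem chartCoord_eq {j : J} {l : W j →ₗ[ℂ] (Fin (k j) → ℂ)} {a : Fin (k j) → ℂ}
    {f : Module.Dual ℂ (W j)} {y : E × (∀ j, Grass (W j) (k j))} (hy : y ∈ chartDomain E j l)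
    {w : W j} (hw : w ∈ (y.2 j).1) (hl : l w = a) : chartCoord E j l a f y = f w := by
  have h : ∃ w ∈ (y.2 j).1, l w = a := ⟨w, hw, hl⟩
  have h1 : h.choose - w = 0 := hy _ (sub_mem h.choose_spec.1 hw) (by
    rw [map_sub, h.choose_spec.2, hl, sub_self])
  rw [chartCoord, dif_pos h, sub_eq_zero.1 h1]

/-- The matrix of the restriction of `l` to the span of the `j`-th frame. -/
def frameMatrix (j : J) (l : W j →ₗ[ℂ] (Fin (k j) → ℂ)) (p : E × (∀ j, Fin (k j) → W j)) :
    Matrix (Fin (k j)) (Fin (k j)) ℂ :=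
  Matrix.of fun t s => l (p.2 j s) t

theorem frameMatrix_mulVec (j : J) (l : W j →ₗ[ℂ] (Fin (k j) → ℂ))
    (p : E × (∀ j, Fin (k j) → W j)) (c : Fin (k j) → ℂ) :
    (frameMatrix j l p).mulVec c = l (∑ s, c s • p.2 j s) := by
  ext t
  simp [frameMatrix, Matrix.mulVec, dotProduct, mul_comm]

theorem framedMap_mem_chartDomain (j : J) (l : W j →ₗ[ℂ] (Fin (k j) → ℂ))
    (p : framedSet E W k) :
    framedMap E W k p ∈ chartDomain E j l ↔ (frameMatrix j l p.1).det ≠ 0 := by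
  rw [← isUnit_iff_ne_zero, ← Matrix.isUnit_iff_isUnit_det, ← Matrix.mulVec_injective_iff_isUnit]
  have hp := p.2 j
  constructor
  · intro h c c' hc
    simp only [frameMatrix_mulVec] at hc
    have h1 := h (∑ s, c s • p.1.2 j s - ∑ s, c' s • p.1.2 j s)
      (sub_mem (Submodule.sum_mem _ fun s _ => Submodule.smul_mem _ _
        (Submodule.subset_span ⟨s, rfl⟩)) (Submodule.sum_mem _ fun s _ => Submodule.smul_mem _ _
        (Submodule.subset_span ⟨s, rfl⟩))) (by rw [map_sub, hc, sub_self])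
    rw [← Finset.sum_sub_distrib] at h1
    simp only [← sub_smul] at h1
    ext s
    exact sub_eq_zero.1 (Fintype.linearIndependent_iff.1 hp (fun s => c s - c' s) h1 s)
  · intro h w hw hl
    obtain ⟨c, rfl⟩ := (Submodule.mem_span_range_iff_exists_fun ℂ).1 hw
    have : c = 0 := h (by rw [frameMatrix_mulVec, hl, Matrix.mulVec_zero])
    simp [this]

variable [AddCommGroup E] [Module ℂ E]

theorem frameMatrix_mem_polyFunctions (j : J) (l : W j →ₗ[ℂ] (Fin (k j) → ℂ)) (t s : Fin (k j)) :
    (fun p : E × (∀ j, Fin (k j) → W j) => frameMatrix j l p t s) ∈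
      polyFunctions (E × (∀ j, Fin (k j) → W j)) :=
  linear_mem_polyFunctions (LinearMap.proj t ∘ₗ l ∘ₗ LinearMap.proj s ∘ₗ LinearMap.proj j ∘ₗ
    LinearMap.snd ℂ E (∀ j, Fin (k j) → W j))

theorem isOpen_chartDomain (j : J) (l : W j →ₗ[ℂ] (Fin (k j) → ℂ)) :
    IsOpen[(grassmannianProduct E W k).top] (chartDomain E j l) := by
  refine ⟨{p | (frameMatrix j l p).det ≠ 0}, TopologicalSpace.isOpen_generateFrom_of_mem
    ⟨_, det_mem_polyFunctions (frameMatrix_mem_polyFunctions j l), rfl⟩, ?_⟩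
  ext p
  exact (framedMap_mem_chartDomain j l p).symm

/-- On a frame, the coordinates of a chart are given by Cramer's rule. -/
theorem isRegularAt_chartCoord (j : J) (l : W j →ₗ[ℂ] (Fin (k j) → ℂ)) (a : Fin (k j) → ℂ)
    (f : Module.Dual ℂ (W j)) {y : E × (∀ j, Grass (W j) (k j))} (hy : y ∈ chartDomain E j l) :
    (grassmannianProduct E W k).IsRegularAt y (chartCoord E j l a f) := by
  refine ⟨_, isOpen_chartDomain j l, hy, fun p hp => ?_⟩
  have hdet := det_mem_polyFunctions (frameMatrix_mem_polyFunctions (E := E) j l)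
  rw [framedMap_mem_chartDomain] at hp
  refine ⟨fun p => (∑ s, (frameMatrix j l p).adjugate.mulVec a s * f (p.2 j s)) /
    (frameMatrix j l p).det, SpaceWithFunctions.isRegularAt_affine_div ?_ hdet hp, ?_⟩
  · refine sum_mem_polyFunctions (E := E × (∀ j, Fin (k j) → W j)) _ fun s _ => mul_mem ?_ ?_
    · simp only [Matrix.mulVec, dotProduct]
      exact sum_mem_polyFunctions (E := E × (∀ j, Fin (k j) → W j)) _ fun t _ => mul_mem
        (adjugate_mem_polyFunctions (frameMatrix_mem_polyFunctions j l) s t)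
        (const_mem_polyFunctions _)
    · exact linear_mem_polyFunctions (f ∘ₗ LinearMap.proj s ∘ₗ LinearMap.proj j ∘ₗ
        LinearMap.snd ℂ E (∀ j, Fin (k j) → W j))
  · let := zariskiTopology (E × (∀ j, Fin (k j) → W j))
    refine Filter.mem_of_superset (IsOpen.mem_nhds (s := Subtype.val ⁻¹'
      {p | (frameMatrix j l p).det ≠ 0}) ⟨_, TopologicalSpace.isOpen_generateFrom_of_mem
        ⟨_, hdet, rfl⟩, rfl⟩ hp) ?_
    intro q hq
    have hq' : (frameMatrix j l q.1).det ≠ 0 := hq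
    have h1 := chartCoord_eq (f := f) (a := a) ((framedMap_mem_chartDomain j l q).2 hq')
      (w := ∑ s, (((frameMatrix j l q.1).det)⁻¹ • (frameMatrix j l q.1).adjugate.mulVec a) s •
        q.1.2 j s) (Submodule.sum_mem _ fun s _ => Submodule.smul_mem _ _
        (Submodule.subset_span ⟨s, rfl⟩)) (by
          rw [← frameMatrix_mulVec, Matrix.mulVec_smul, Matrix.mulVec_mulVec,
            Matrix.mul_adjugate, Matrix.smul_mulVec, Matrix.one_mulVec, smul_smul,
            inv_mul_cancel₀ hq', one_smul])
    refine h1.trans ?_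
    simp only [Function.comp, map_sum, map_smul, Pi.smul_apply, smul_eq_mul, Finset.sum_div]
    refine Finset.sum_congr rfl fun s _ => ?_
    field_simp

/-- The dimension of the intersection of the `j`-th subspace with a fixed subspace `A` is upper
semicontinuous: near `U₀`, a projection along a complement of `U₀` which maps `A` to `U₀ ⊓ A` is
injective on the subspaces `U`, hence embeds `U ⊓ A` in `U₀ ⊓ A`. -/
theorem eventually_finrank_inf_le [∀ j, FiniteDimensional ℂ (W j)]
    (y : E × (∀ j, Grass (W j) (k j))) (j : J) (A : Submodule ℂ (W j)) :
    ∀ᶠ z in @nhds _ (grassmannianProduct E W k).top y,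
      Module.finrank ℂ ((z.2 j).1 ⊓ A : Submodule ℂ (W j)) ≤
        Module.finrank ℂ ((y.2 j).1 ⊓ A : Submodule ℂ (W j)) := by
  set U := (y.2 j).1 with hU
  obtain ⟨C₀, hd, hs⟩ := IsModularLattice.exists_disjoint_and_sup_eq (inf_le_right : U ⊓ A ≤ A)
  have hC₀ : C₀ ≤ A := hs ▸ le_sup_right
  have hdU : Disjoint C₀ U := by
    rw [disjoint_iff_inf_le] at hd ⊢
    exact le_trans (le_inf (le_inf inf_le_right (inf_le_left.trans hC₀)) inf_le_left) hd
  obtain ⟨C, hC₀C, hC⟩ := hdU.exists_isCompl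
  let e : U ≃ₗ[ℂ] (Fin (k j) → ℂ) := LinearEquiv.ofFinrankEq _ _ (by
    rw [hU, (y.2 j).2, Module.finrank_fin_fun])
  let l : W j →ₗ[ℂ] (Fin (k j) → ℂ) := e.toLinearMap ∘ₗ U.projectionOnto C hC.symm
  have hl : ∀ w ∈ C, l w = 0 := fun w hw => by
    simp [l, (Submodule.projectionOnto_apply_eq_zero_iff hC.symm).2 hw]
  have hy : y ∈ chartDomain E j l := fun w hw h => by
    have h1 : U.projectionOnto C hC.symm w = 0 := e.injective (by simpa [l] using h)
    rw [Submodule.projectionOnto_apply_of_mem_left _ hw] at h1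
    exact congrArg Subtype.val h1
  let := (grassmannianProduct E W k).top
  filter_upwards [(isOpen_chartDomain j l).mem_nhds hy] with z hz
  have h1 : Module.finrank ℂ (((z.2 j).1 ⊓ A).map l) =
      Module.finrank ℂ ((z.2 j).1 ⊓ A : Submodule ℂ (W j)) :=
    LinearEquiv.finrank_eq (LinearEquiv.symm (LinearEquiv.ofBijective (l.submoduleMap _)
      ⟨LinearMap.submoduleMap_injective_of_injOn (fun a ha b hb hab => sub_eq_zero.1
        (hz _ (sub_mem ha.1 hb.1) (by rw [map_sub, hab, sub_self]))),
        l.submoduleMap_surjective _⟩))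
  have h2 : ((z.2 j).1 ⊓ A).map l ≤ (U ⊓ A).map l := by
    refine (Submodule.map_mono inf_le_right).trans ?_
    rw [← hs, Submodule.map_sup, hs]
    refine sup_le le_rfl ?_
    rintro _ ⟨w, hw, rfl⟩
    rw [hl w (hC₀C hw)]
    exact zero_mem _
  rw [← h1]
  exact (Submodule.finrank_mono h2).trans (Submodule.finrank_map_le _ _)

end GrassmannianCharts

/-! ### Affine cell decompositions from semicontinuous invariants -/

namespace SpaceWithFunctions

theorem isRegularAt_sum {X ι : Type*} (S : SpaceWithFunctions X) (x : X) (s : Finset ι)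
    (f : ι → X → ℂ) (h : ∀ i ∈ s, S.IsRegularAt x (f i)) :
    S.IsRegularAt x (fun a => ∑ i ∈ s, f i a) := by
  classical
  induction s using Finset.induction_on with
  | empty => simpa using S.const x 0
  | insert i s hi ih =>
    simp only [Finset.sum_insert hi]
    exact S.add x _ _ (h i (Finset.mem_insert_self _ _))
      (ih fun j hj => h j (Finset.mem_insert_of_mem hj))

/-- A space parametrized by a morphism from an affine space, such that the coordinates are regular
functions of the parametrized point, is isomorphic to the affine space. -/
theorem nonempty_iso_affine {X : Type*} (S : SpaceWithFunctions X) {n : ℕ} (f : (Fin n → ℂ) → X)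
    (hf : IsMorphism (affine (Fin n → ℂ)) S f) (g : X → Fin n → ℂ)
    (hg : ∀ t x, S.IsRegularAt x (fun a => g a t)) (hfg : ∀ x, f (g x) = x)
    (hgf : ∀ z, g (f z) = z) : Nonempty (Iso S (affine (Fin n → ℂ))) := by
  refine ⟨Iso.ofIsMorphism ⟨g, f, hfg, hgf⟩ (isMorphism_affine S fun l x => ?_) hf⟩
  have h1 : (fun a => l (g a)) = fun a => ∑ t, g a t * l (Pi.single t 1) := by
    ext a
    conv_lhs => rw [← LinearMap.sum_single_apply _ (g a)]
    simp only [map_sum]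
    refine Finset.sum_congr rfl fun t _ => ?_
    rw [← smul_eq_mul, ← map_smul, ← Pi.single_smul, smul_eq_mul, mul_one]
  change S.IsRegularAt x (fun a => l (g a))
  rw [h1]
  exact isRegularAt_sum S x _ _ fun t _ => S.mul x _ _ (hg t x) (S.const x _)

/-- A bounded upper semicontinuous family `d` of integer invariants, whose strata `{d = c}` are
affine spaces, gives an affine cell decomposition: the strata are enumerated in decreasing order
of the sum of the invariants, so that the union of the first ones is closed. -/
theorem hasAffineCellDecomposition_of_semicontinuous {X T : Type*} [Finite T]
    (S : SpaceWithFunctions X) (d : X → T → ℕ) (B : T → ℕ) (hB : ∀ x, d x ≤ B)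
    (hd : ∀ x, ∀ᶠ z in @nhds X S.top x, d z ≤ d x)
    (hcell : ∀ x₀, ∃ n : ℕ,
      Nonempty (Iso (S.restrict {x | d x = d x₀}) (affine (Fin n → ℂ)))) :
    S.HasAffineCellDecomposition := by
  classical
  have := Fintype.ofFinite T
  have hfin : (Set.range d).Finite :=
    (Set.finite_Iic B).subset (by rintro _ ⟨x, rfl⟩; exact hB x)
  have := hfin.to_subtype
  obtain ⟨n, ⟨e₀⟩⟩ := Finite.exists_equiv_fin (Set.range d)
  let s : (T → ℕ) → ℕ := fun c => ∑ t, c t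
  let f : Fin n → ℕᵒᵈ := fun r => OrderDual.toDual (s (e₀.symm r).1)
  let e : Fin n ≃ Set.range d := (Tuple.sort f).trans e₀.symm
  have he : ∀ a b, a ≤ b → s (e b).1 ≤ s (e a).1 := fun a b hab => Tuple.monotone_sort f hab
  have hdiff : ∀ r : Fin n, ({x | ∃ a : Fin n, a.val < r.succ.val ∧ d x = (e a).1} \
      {x | ∃ a : Fin n, a.val < r.castSucc.val ∧ d x = (e a).1}) = {x | d x = (e r).1} := by
    intro r
    ext x
    constructor
    · rintro ⟨⟨a, ha, hx⟩, h2⟩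
      rcases (Nat.lt_succ_iff.1 ha).lt_or_eq with h | h
      · exact (h2 ⟨a, h, hx⟩).elim
      · rw [Fin.ext (show a.val = r.val from h)] at hx
        exact hx
    · intro hx
      refine ⟨⟨r, Nat.lt_succ_self _, hx⟩, ?_⟩
      rintro ⟨a, ha, hx'⟩
      have h1 : r = a := e.injective (Subtype.ext ((show d x = _ from hx).symm.trans hx'))
      subst h1
      exact lt_irrefl _ ha
  refine ⟨n, fun r => {x | ∃ a : Fin n, a.val < r.val ∧ d x = (e a).1}, ?_, ?_, ?_, ?_⟩
  · simp
  · refine Set.eq_univ_of_forall fun x => ⟨e.symm ⟨d x, x, rfl⟩, (e.symm _).2, by simp⟩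
  · intro r
    let := S.top
    rw [← isOpen_compl_iff, isOpen_iff_mem_nhds]
    intro x hx
    filter_upwards [hd x] with z hz
    rintro ⟨a, ha, hza⟩
    obtain ⟨b, hb⟩ := e.surjective ⟨d x, x, rfl⟩
    have hxb : d x = (e b).1 := by rw [hb]
    have hrb : r.val ≤ b.val := not_lt.1 fun h => hx ⟨b, h, hxb⟩
    have h1 := he a b (Fin.le_def.2 (ha.le.trans hrb))
    rw [← hxb, ← hza] at h1
    -- equal sums together with `d z ≤ d x` force `d z = d x`
    have h2 : d z = d x := by
      funext t
      exact (Finset.sum_eq_sum_iff_of_le fun t _ => hz t).1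
        (le_antisymm (Finset.sum_le_sum fun t _ => hz t) h1) t (Finset.mem_univ t)
    exact hx ⟨a, ha, h2 ▸ hza⟩
  · intro r
    refine ⟨?_, ?_⟩
    · rintro x ⟨a, ha, hx⟩
      exact ⟨a, ha.trans (Nat.lt_succ_self _), hx⟩
    · obtain ⟨x₀, hx₀⟩ := (e r).2
      rw [hdiff r, ← hx₀]
      exact hcell x₀

end SpaceWithFunctions

/-! ### Numbering the vertices of a quiver of type A -/

/-- Two vertices are linked if there is an arrow between them. -/
def IsLinked {I : Type*} [Quiver I] (i j : I) : Prop := Nonempty ((i ⟶ j) ⊕ (j ⟶ i))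

theorem IsLinked.symm {I : Type*} [Quiver I] {i j : I} (h : IsLinked i j) : IsLinked j i :=
  h.elim fun a => a.elim (fun a => ⟨.inr a⟩) fun a => ⟨.inl a⟩

/-- A position function on the vertices of a quiver which makes each connected component a segment:
arrows join vertices in consecutive positions, there is at most one arrow between two vertices,
and a vertex is linked to at most one vertex in each position. -/
structure IsLinePosition {I : Type*} [Quiver I] (pos : I → ℕ) : Prop where
  adj : ∀ {i j : I}, (i ⟶ j) → pos j = pos i + 1 ∨ pos i = pos j + 1
  eq_of_isLinked : ∀ {i j k : I}, IsLinked i j → IsLinked i k → pos j = pos k → j = k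
  subsingleton : ∀ i j : I, Subsingleton ((i ⟶ j) ⊕ (j ⟶ i))

theorem IsQuiverOfTypeA.exists_isLinePosition {I : Type*} [Quiver I] (hI : IsQuiverOfTypeA I) :
    ∃ pos : I → ℕ, IsLinePosition pos := by
  choose n _ e he using hI
  let idx : ∀ (c : Quiver.WeaklyConnectedComponent I) (i : I)
    (_ : (i : Quiver.WeaklyConnectedComponent I) = c), Fin (n c) :=
    fun c i h => (e c).symm ⟨i, h⟩
  have hidx : ∀ c i h, (e c (idx c i h)).1 = i := fun c i h => by simp [idx]
  have hcomp : ∀ {i j : I}, IsLinked i j → (j : Quiver.WeaklyConnectedComponent I) = i := by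
    rintro i j ⟨h | h⟩
    · exact (Quiver.WeaklyConnectedComponent.eq j i).2 ⟨(Quiver.Hom.toNeg h).toPath⟩
    · exact (Quiver.WeaklyConnectedComponent.eq j i).2 ⟨(Quiver.Hom.toPos h).toPath⟩
  let pos : I → ℕ := fun i => (idx i i rfl).val
  have hpos : ∀ c i h, pos i = (idx c i h).val := by
    rintro c i rfl
    rfl
  refine ⟨pos, ?_, ?_, ?_⟩
  · intro i j h
    have hj := hcomp ⟨.inl h⟩
    rw [hpos _ j hj]
    by_contra! hne
    have := (he i (idx i i rfl) (idx i j hj)).2 (fun h => hne.1 h.symm) (fun h => hne.2 h.symm)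
    rw [hidx, hidx] at this
    exact this.false h
  · intro i j k hj hk hjk
    rw [hpos _ j (hcomp hj), hpos _ k (hcomp hk)] at hjk
    rw [← hidx i j (hcomp hj), ← hidx i k (hcomp hk), Fin.ext hjk]
  · intro i j
    by_cases hl : IsLinked i j
    · have hj := hcomp hl
      have h1 := he i (idx i i rfl) (idx i j hj)
      have h2 := he i (idx i j hj) (idx i i rfl)
      rw [hidx, hidx] at h1 h2
      by_cases hij : (idx i i rfl).val + 1 = (idx i j hj).val
      · obtain ⟨hu⟩ := h1.1 hij
        infer_instance
      · by_cases hji : (idx i j hj).val + 1 = (idx i i rfl).val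
        · obtain ⟨hu⟩ := h2.1 hji
          exact (Equiv.sumComm _ _).subsingleton
        · have := h1.2 hij hji
          have := h2.2 hji hij
          infer_instance
    · exact ⟨fun a => (hl ⟨a⟩).elim⟩

/-- Dependent choice along a forest: if each vertex has at most one parent, and any choice at the
parent can be extended to the child, then there is a compatible family of choices. -/
theorem exists_compatible_family {I : Type*} (pos : I → ℕ) {D : I → Type*} [∀ i, Nonempty (D i)]
    (par : I → I → Prop) (R : ∀ i j, D i → D j → Prop)
    (hpos : ∀ {i j}, par i j → pos i < pos j)
    (huniq : ∀ {i i' j}, par i j → par i' j → i = i')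
    (hstep : ∀ {i j}, par i j → ∀ d : D i, ∃ d' : D j, R i j d d') :
    ∃ d : ∀ i, D i, ∀ i j, par i j → R i j (d i) (d j) := by
  classical
  let F : ∀ j, (∀ i, pos i < pos j → D i) → D j := fun j rec =>
    if h : ∃ i, par i j then
      (hstep h.choose_spec (rec h.choose (hpos h.choose_spec))).choose
    else Classical.arbitrary _
  let d : ∀ i, D i := (measure pos).wf.fix F
  refine ⟨d, fun i j hij => ?_⟩
  have h : ∃ i, par i j := ⟨i, hij⟩
  obtain rfl := huniq h.choose_spec hij
  have hd : d j = F j fun i _ => d i := (measure pos).wf.fix_eq F j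
  have h1 : d j = (hstep h.choose_spec (d h.choose)).choose := by
    rw [hd]
    exact dif_pos h
  rw [h1]
  exact (hstep h.choose_spec (d h.choose)).choose_spec

/-! ### Labelled complete flags and adapted bases -/

section LabelledFlag

variable {V V' : Type*} [AddCommGroup V] [Module ℂ V] [AddCommGroup V'] [Module ℂ V']

/-- A complete flag of a vector space, labelled by integers: an increasing family of subspaces
from `⊥` to `⊤`, each of codimension at most one in the next. -/
structure LabelledFlag (V : Type*) [AddCommGroup V] [Module ℂ V] where
  step : ℤ → Submodule ℂ V
  mono : Monotone step
  exists_bot : ∃ a, step a = ⊥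
  exists_top : ∃ b, step b = ⊤
  exists_sub_smul_mem : ∀ p, ∀ u ∈ step p, ∀ w ∈ step p, w ∉ step (p - 1) →
    ∃ t : ℂ, u - t • w ∈ step (p - 1)

namespace LabelledFlag

/-- The labels at which a flag jumps; they label the vectors of an adapted basis. -/
def jumps (F : LabelledFlag V) : Set ℤ := {p | F.step (p - 1) ≠ F.step p}

/-- A family of vectors adapted to a flag: at each jump `p` a vector of the `p`-th step outside
the previous one, and zero at the other labels. -/
structure IsAdapted (F : LabelledFlag V) (c : ℤ → V) : Prop where
  mem : ∀ p ∈ F.jumps, c p ∈ F.step p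
  notMem : ∀ p ∈ F.jumps, c p ∉ F.step (p - 1)
  eq_zero : ∀ p ∉ F.jumps, c p = 0

theorem step_eq_bot (F : LabelledFlag V) {a p : ℤ} (ha : F.step a = ⊥) (h : p ≤ a) :
    F.step p = ⊥ := le_bot_iff.1 (ha ▸ F.mono h)

theorem step_eq_top (F : LabelledFlag V) {b p : ℤ} (hb : F.step b = ⊤) (h : b ≤ p) :
    F.step p = ⊤ := top_le_iff.1 (hb ▸ F.mono h)

theorem lt_of_mem_jumps (F : LabelledFlag V) {a p : ℤ} (ha : F.step a = ⊥) (hp : p ∈ F.jumps) :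
    a < p := by
  by_contra! h
  exact hp (by rw [F.step_eq_bot ha h, F.step_eq_bot ha (by lia)])

theorem le_of_mem_jumps (F : LabelledFlag V) {b p : ℤ} (hb : F.step b = ⊤) (hp : p ∈ F.jumps) :
    p ≤ b := by
  by_contra! h
  exact hp (by rw [F.step_eq_top hb h.le, F.step_eq_top hb (by lia)])

theorem exists_mem_notMem (F : LabelledFlag V) {p : ℤ} (hp : p ∈ F.jumps) :
    ∃ v ∈ F.step p, v ∉ F.step (p - 1) := by
  by_contra! h
  exact hp (le_antisymm (F.mono (by lia)) h)

theorem exists_isAdapted_of (F : LabelledFlag V) (Q : ℤ → V → Prop)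
    (h : ∀ p ∈ F.jumps, ∃ v ∈ F.step p, v ∉ F.step (p - 1) ∧ Q p v) :
    ∃ c, F.IsAdapted c ∧ ∀ p ∈ F.jumps, Q p (c p) := by
  classical
  choose! c h1 h2 h3 using h
  refine ⟨fun p => if p ∈ F.jumps then c p else 0, ⟨?_, ?_, ?_⟩, ?_⟩
  · intro p hp
    simpa [hp] using h1 p hp
  · intro p hp
    simpa [hp] using h2 p hp
  · intro p hp
    simp [hp]
  · intro p hp
    simpa [hp] using h3 p hp

theorem exists_isAdapted (F : LabelledFlag V) : ∃ c, F.IsAdapted c := by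
  obtain ⟨c, hc, -⟩ := F.exists_isAdapted_of (fun _ _ => True) fun p hp => by
    obtain ⟨v, h1, h2⟩ := F.exists_mem_notMem hp
    exact ⟨v, h1, h2, trivial⟩
  exact ⟨c, hc⟩

/-- The flag of the coordinate subspaces of a basis. -/
theorem exists_nat_flag (V : Type*) [AddCommGroup V] [Module ℂ V] [FiniteDimensional ℂ V] :
    ∃ C : ℕ → Submodule ℂ V, Monotone C ∧ C 0 = ⊥ ∧ (∃ N, C N = ⊤) ∧
      ∀ n, ∀ u ∈ C (n + 1), ∀ w ∈ C (n + 1), w ∉ C n → ∃ t : ℂ, u - t • w ∈ C n := by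
  let b := Module.finBasis ℂ V
  let C : ℕ → Submodule ℂ V := fun n =>
    { carrier := {v | ∀ i : Fin (Module.finrank ℂ V), n ≤ i.val → b.repr v i = 0}
      add_mem' := fun hu hv i hi => by simp [hu i hi, hv i hi]
      zero_mem' := fun i _ => by simp
      smul_mem' := fun t v hv i hi => by simp [hv i hi] }
  have hC : ∀ n v, v ∈ C n ↔ ∀ i : Fin (Module.finrank ℂ V), n ≤ i.val → b.repr v i = 0 :=
    fun _ _ => Iff.rfl
  refine ⟨C, fun m n hmn v hv i hi => hv i (hmn.trans hi), ?_, ⟨Module.finrank ℂ V, ?_⟩, ?_⟩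
  · refine (Submodule.eq_bot_iff _).2 fun v hv => b.repr.map_eq_zero_iff.1 ?_
    ext i
    exact hv i (Nat.zero_le _)
  · exact top_le_iff.1 fun v _ i hi => absurd i.2 (not_lt.2 hi)
  · intro n u hu w hw hwn
    rw [hC] at hwn
    push Not at hwn
    obtain ⟨i, hi, hwi⟩ := hwn
    have hin : i.val = n := le_antisymm (by
      by_contra! h
      exact hwi (hw i h)) hi
    refine ⟨b.repr u i / b.repr w i, fun j hj => ?_⟩
    rcases hj.lt_or_eq with h | h
    · simp [hu j h, hw j h]
    · have : j = i := Fin.ext (by rw [← h, hin])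
      subst this
      simp [hwi]

instance [FiniteDimensional ℂ V] : Nonempty (LabelledFlag V) := by
  obtain ⟨C, hm, h0, ⟨N, hN⟩, hC⟩ := exists_nat_flag V
  refine ⟨⟨fun p => C p.toNat, fun p q h => hm (by lia), ⟨0, by simpa⟩, ⟨N, by simpa⟩, ?_⟩⟩
  intro p u hu w hw hwp
  rcases le_or_gt p 0 with h | h
  · exact (hwp (by rwa [show (p - 1).toNat = p.toNat by lia])).elim
  · have h1 : p.toNat = (p - 1).toNat + 1 := by lia
    rw [h1] at hu hw
    exact hC _ u hu w hw hwp

/-- Propagation of flags along a map `x : V → V'`: the images of the steps are completed to a flag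
by steps with larger labels.  Adapted bases of the target lift to the source. -/
theorem exists_map [FiniteDimensional ℂ V'] (x : V →ₗ[ℂ] V') (F : LabelledFlag V) :
    ∃ F' : LabelledFlag V', (∀ p ∈ F.jumps, ∀ q ∈ F'.jumps, q ∉ F.jumps → p < q) ∧
      ∀ c', F'.IsAdapted c' → ∃ c, F.IsAdapted c ∧ ∀ p ∈ F.jumps, x (c p) = c' p := by
  obtain ⟨a, ha⟩ := F.exists_bot
  obtain ⟨b, hb⟩ := F.exists_top
  obtain ⟨C, hm, h0, ⟨N, hN⟩, hC⟩ := exists_nat_flag V'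
  let st : ℤ → Submodule ℂ V' := fun p => (F.step p).map x ⊔ C (p - b).toNat
  have hle : ∀ p ≤ b, st p = (F.step p).map x := fun p hp => by
    have : (p - b).toNat = 0 := by lia
    simp [st, this, h0]
  let F' : LabelledFlag V' :=
    { step := st
      mono := fun p q h => sup_le_sup (Submodule.map_mono (F.mono h)) (hm (by lia))
      exists_bot := ⟨min a b, by
        rw [hle _ (min_le_right _ _), F.step_eq_bot ha (min_le_left _ _), Submodule.map_bot]⟩
      exists_top := ⟨b + N, by simp [st, hN]⟩
      exists_sub_smul_mem := by
        intro p u hu w hw hwp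
        rcases le_or_gt p b with hp | hp
        · rw [hle _ hp] at hu hw
          rw [hle _ (by lia)] at hwp ⊢
          obtain ⟨u, hu, rfl⟩ := hu
          obtain ⟨w, hw, rfl⟩ := hw
          obtain ⟨t, ht⟩ := F.exists_sub_smul_mem p u hu w hw fun h => hwp ⟨w, h, rfl⟩
          exact ⟨t, _, ht, by simp⟩
        · have h1 : (p - b).toNat = (p - 1 - b).toNat + 1 := by lia
          have h2 : F.step p = F.step (p - 1) := by
            rw [F.step_eq_top hb hp.le, F.step_eq_top hb (by lia)]
          simp only [st, h1, h2] at hu hw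
          obtain ⟨u₁, hu₁, u₂, hu₂, rfl⟩ := Submodule.mem_sup.1 hu
          obtain ⟨w₁, hw₁, w₂, hw₂, rfl⟩ := Submodule.mem_sup.1 hw
          obtain ⟨t, ht⟩ := hC _ u₂ hu₂ w₂ hw₂ fun h =>
            hwp (Submodule.add_mem_sup hw₁ h)
          refine ⟨t, ?_⟩
          rw [smul_add, add_sub_add_comm]
          exact Submodule.add_mem_sup (sub_mem hu₁ (Submodule.smul_mem _ _ hw₁)) ht }
  have hle' : ∀ p ≤ b, F'.step p = (F.step p).map x := hle
  refine ⟨F', fun p hp q hq hq' => ?_, fun c' hc' => ?_⟩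
  · by_contra! h
    have hqb := h.trans (F.le_of_mem_jumps hb hp)
    refine hq ?_
    rw [hle' _ (by lia), hle' _ hqb, not_not.1 hq']
  · refine F.exists_isAdapted_of (fun p v => x v = c' p) fun p hp => ?_
    have hpb := F.le_of_mem_jumps hb hp
    by_cases hp' : p ∈ F'.jumps
    · obtain ⟨v, hv, hvc⟩ : c' p ∈ (F.step p).map x := hle' p hpb ▸ hc'.mem p hp'
      refine ⟨v, hv, fun h => hc'.notMem p hp' ?_, hvc⟩
      rw [hle' _ (by lia), ← hvc]
      exact ⟨v, h, rfl⟩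
    · obtain ⟨w, hw, hwp⟩ := F.exists_mem_notMem hp
      have h1 : x w ∈ (F.step (p - 1)).map x := by
        rw [← hle' _ (by lia), not_not.1 hp', hle' _ hpb]
        exact ⟨w, hw, rfl⟩
      obtain ⟨w', hw', hww⟩ := h1
      refine ⟨w - w', sub_mem hw (F.mono (by lia) hw'), fun h => hwp ?_, ?_⟩
      · simpa using add_mem h hw'
      · rw [map_sub, hww, sub_self, hc'.eq_zero p hp']

/-- Propagation of flags along a map `x : V' → V`, from the target to the source: the preimages
of the steps are completed to a flag by steps of the kernel with smaller labels.  Adapted bases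
of the source push forward to the target. -/
theorem exists_comap [FiniteDimensional ℂ V'] (x : V' →ₗ[ℂ] V) (F : LabelledFlag V) :
    ∃ F' : LabelledFlag V', (∀ p ∈ F'.jumps, p ∉ F.jumps → ∀ q ∈ F.jumps, p < q) ∧
      ∀ c', F'.IsAdapted c' → ∃ c, F.IsAdapted c ∧ ∀ p ∈ F'.jumps, x (c' p) = c p := by
  obtain ⟨a, ha⟩ := F.exists_bot
  obtain ⟨b, hb⟩ := F.exists_top
  obtain ⟨C, hm, h0, ⟨N, hN⟩, hC⟩ := exists_nat_flag V'
  let st : ℤ → Submodule ℂ V' := fun p => (F.step p).comap x ⊓ C (p - a + N).toNat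
  have hge : ∀ p, a ≤ p → st p = (F.step p).comap x := fun p hp => by
    have h1 : N ≤ (p - a + N).toNat := by lia
    have : C (p - a + N).toNat = ⊤ := top_le_iff.1 (hN ▸ hm h1)
    simp [st, this]
  let F' : LabelledFlag V' :=
    { step := st
      mono := fun p q h => inf_le_inf (Submodule.comap_mono (F.mono h)) (hm (by lia))
      exists_bot := ⟨a - N, by simp [st, h0]⟩
      exists_top := ⟨max a b, by
        rw [hge _ (le_max_left _ _), F.step_eq_top hb (le_max_right _ _), Submodule.comap_top]⟩
      exists_sub_smul_mem := by
        intro p u hu w hw hwp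
        rcases lt_or_ge a p with hp | hp
        · rw [hge _ hp.le] at hu hw
          rw [hge _ (by lia)] at hwp ⊢
          obtain ⟨t, ht⟩ := F.exists_sub_smul_mem p _ hu _ hw hwp
          exact ⟨t, by simpa using ht⟩
        · have h2 : F.step p = F.step (p - 1) := by
            rw [F.step_eq_bot ha hp, F.step_eq_bot ha (by lia)]
          simp only [st, h2] at hu hw
          have hwC : w ∉ C (p - 1 - a + N).toNat := fun h => hwp ⟨hw.1, h⟩
          have h1 : (p - a + N).toNat = (p - 1 - a + N).toNat + 1 := by
            by_contra h
            have h3 : (p - a + N).toNat = (p - 1 - a + N).toNat := by lia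
            exact hwC (h3 ▸ hw.2)
          rw [h1] at hu hw
          obtain ⟨t, ht⟩ := hC _ u hu.2 w hw.2 hwC
          exact ⟨t, sub_mem hu.1 (Submodule.smul_mem _ _ hw.1), ht⟩ }
  have hge' : ∀ p, a ≤ p → F'.step p = (F.step p).comap x := hge
  have hpa : ∀ p ∈ F'.jumps, p ∉ F.jumps → p ≤ a := fun p hp hp' => by
    by_contra! h
    refine hp ?_
    rw [hge' _ (by lia), hge' _ h.le, not_not.1 hp']
  refine ⟨F', fun p hp hp' q hq => (hpa p hp hp').trans_lt (F.lt_of_mem_jumps ha hq),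
    fun c' hc' => ?_⟩
  obtain ⟨c, hc, hcc⟩ := F.exists_isAdapted_of (fun p v => p ∈ F'.jumps → x (c' p) = v)
    fun p hp => by
      have hap := F.lt_of_mem_jumps ha hp
      by_cases hp' : p ∈ F'.jumps
      · refine ⟨x (c' p), ?_, fun h => hc'.notMem p hp' ?_, fun _ => rfl⟩
        · have := hc'.mem p hp'
          rwa [hge' _ hap.le] at this
        · rw [hge' _ (by lia)]
          exact h
      · obtain ⟨w, hw, hwp⟩ := F.exists_mem_notMem hp
        exact ⟨w, hw, hwp, fun h => (hp' h).elim⟩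
  refine ⟨c, hc, fun p hp => ?_⟩
  by_cases hpF : p ∈ F.jumps
  · exact hcc p hpF hp
  · have h1 := hc'.mem p hp
    have h2 : x (c' p) ∈ F.step p := h1.1
    rw [F.step_eq_bot ha (hpa p hp hpF)] at h2
    rw [(Submodule.mem_bot ℂ).1 h2, hc.eq_zero p hpF]

end LabelledFlag

end LabelledFlag

namespace LabelledFlag

variable {V : Type*} [AddCommGroup V] [Module ℂ V] {F : LabelledFlag V} {c : ℤ → V}

theorem finite_jumps (F : LabelledFlag V) : F.jumps.Finite := by
  obtain ⟨a, ha⟩ := F.exists_bot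
  obtain ⟨b, hb⟩ := F.exists_top
  exact (Set.finite_Ioc a b).subset fun p hp =>
    ⟨F.lt_of_mem_jumps ha hp, F.le_of_mem_jumps hb hp⟩

theorem IsAdapted.step_le_span (hc : F.IsAdapted c) (p : ℤ) :
    F.step p ≤ Submodule.span ℂ (Set.range fun q : F.jumps => c q) := by
  obtain ⟨a, ha⟩ := F.exists_bot
  rcases le_total p a with hp | hp
  · rw [F.step_eq_bot ha hp]
    exact bot_le
  · induction p, hp using Int.leInduction with
    | base => exact ha.le.trans bot_le
    | succ p hp ih =>
      intro u hu
      by_cases hj : p + 1 ∈ F.jumps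
      · have h1 := hc.mem _ hj
        have h2 := hc.notMem _ hj
        obtain ⟨t, ht⟩ := F.exists_sub_smul_mem (p + 1) u hu _ h1 h2
        rw [add_sub_cancel_right] at ht
        have h3 := add_mem (ih ht) (Submodule.smul_mem _ t (Submodule.subset_span ⟨⟨_, hj⟩, rfl⟩))
        rwa [sub_add_cancel] at h3
      · have h1 := not_not.1 hj
        rw [add_sub_cancel_right] at h1
        exact ih (h1 ▸ hu)

theorem IsAdapted.linearIndependent (hc : F.IsAdapted c) :
    LinearIndependent ℂ (fun q : F.jumps => c q) := by
  classical
  have := F.finite_jumps.fintype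
  rw [Fintype.linearIndependent_iff]
  intro g hg
  by_contra! hne
  -- the largest label with a nonzero coefficient gives a vector in the previous step
  obtain ⟨p, hp, hmax⟩ := (Finset.univ.filter fun p => g p ≠ 0).exists_maximal
    (by obtain ⟨p, hp⟩ := hne; exact ⟨p, by simpa using hp⟩)
  have hgp : g p ≠ 0 := by simpa using hp
  rw [Finset.sum_eq_add_sum_sdiff_singleton_of_mem (Finset.mem_univ p)] at hg
  have h1 : ∑ q ∈ Finset.univ \ {p}, g q • c q ∈ F.step (p - 1) := by
    refine Submodule.sum_mem _ fun q hq => ?_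
    by_cases hq0 : g q = 0
    · simp [hq0]
    · refine Submodule.smul_mem _ _ (F.mono ?_ (hc.mem q q.2))
      have hqp : ¬ p ≤ q := fun h => by
        have h2 := hmax (by simpa using hq0) h
        have h3 : q = p := le_antisymm h2 h
        simp [h3] at hq
      have : (q : ℤ) < p := not_le.1 hqp
      lia
  refine hc.notMem p p.2 ?_
  rw [← inv_smul_smul₀ hgp (c p), add_eq_zero_iff_eq_neg.1 hg]
  exact Submodule.smul_mem _ _ (neg_mem h1)

end LabelledFlag

/-! ### Adapted bases of a representation -/

/-- Bases `b i` of the spaces `V i`, labelled by finite sets `K i` of integers, in which the arrows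
of a representation `x` send a basis vector to the basis vector with the same label if there is
one, and to zero otherwise; so the representation is split into summands, one for each label, with
spaces of dimension at most one.  The labels which appear when moving right along an arrow are
larger than the previous ones if the arrow points to the right, and smaller if it points to the
left; this order ensures that, for labels `q < p`, there are no nontrivial extensions of the `p`-th
summand by the `q`-th. -/
structure AdaptedBases {I : Type*} [Quiver.{v + 1} I] (pos : I → ℕ) {V : I → Type*}
    [∀ i, AddCommGroup (V i)] [∀ i, Module ℂ (V i)] (x : QuiverRep V) where
  K : I → Finset ℤ
  b : ∀ i, Module.Basis (K i) ℂ (V i)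
  map_of_mem : ∀ {i j : I} (h : i ⟶ j) (p : K i) (hp : (p : ℤ) ∈ K j),
    x i j h (b i p) = b j ⟨p, hp⟩
  map_of_notMem : ∀ {i j : I} (h : i ⟶ j) (p : K i), (p : ℤ) ∉ K j → x i j h (b i p) = 0
  lt_of_right : ∀ {i j : I}, (i ⟶ j) → pos j = pos i + 1 →
    ∀ p ∈ K i, ∀ q ∈ K j, q ∉ K i → p < q
  lt_of_left : ∀ {i j : I}, (i ⟶ j) → pos i = pos j + 1 →
    ∀ p ∈ K i, p ∉ K j → ∀ q ∈ K j, p < q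

/-- A representation of a quiver of type A has adapted bases: flags are propagated from left to
right, and then bases adapted to these flags are chosen from right to left. -/
theorem nonempty_adaptedBases {I : Type*} [Finite I] [Quiver.{v + 1} I] {pos : I → ℕ}
    (hpos : IsLinePosition pos) {V : I → Type*} [∀ i, AddCommGroup (V i)] [∀ i, Module ℂ (V i)]
    [∀ i, FiniteDimensional ℂ (V i)] (x : QuiverRep V) : Nonempty (AdaptedBases pos x) := by
  let par : I → I → Prop := fun i j => IsLinked i j ∧ pos j = pos i + 1
  have hsub : ∀ {i j : I} (h h' : i ⟶ j), h = h' := fun {i j} h h' =>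
    Sum.inl_injective ((hpos.subsingleton i j).elim (.inl h) (.inl h'))
  have hemp : ∀ {i j : I}, (i ⟶ j) → (j ⟶ i) → False := fun {i j} h h' =>
    Sum.inl_ne_inr ((hpos.subsingleton i j).elim (.inl h) (.inr h'))
  obtain ⟨F, hF⟩ := exists_compatible_family pos (D := fun i => LabelledFlag (V i)) par
    (fun i j F F' =>
      (∀ h : i ⟶ j, (∀ p ∈ F.jumps, ∀ q ∈ F'.jumps, q ∉ F.jumps → p < q) ∧
        ∀ c', F'.IsAdapted c' → ∃ c, F.IsAdapted c ∧ ∀ p ∈ F.jumps, x i j h (c p) = c' p) ∧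
      (∀ h : j ⟶ i, (∀ p ∈ F'.jumps, p ∉ F.jumps → ∀ q ∈ F.jumps, p < q) ∧
        ∀ c', F'.IsAdapted c' → ∃ c, F.IsAdapted c ∧ ∀ p ∈ F'.jumps, x j i h (c' p) = c p))
    (fun h => by rw [h.2]; exact Nat.lt_succ_self _)
    (fun h h' => hpos.eq_of_isLinked h.1.symm h'.1.symm (by have := h.2; have := h'.2; lia))
    (by
      rintro i j ⟨⟨h | h⟩, -⟩ F
      · obtain ⟨F', h1, h2⟩ := F.exists_map (x i j h)
        exact ⟨F', fun h' => hsub h h' ▸ ⟨h1, h2⟩, fun h' => (hemp h h').elim⟩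
      · obtain ⟨F', h1, h2⟩ := F.exists_comap (x j i h)
        exact ⟨F', fun h' => (hemp h h').elim, fun h' => hsub h h' ▸ ⟨h1, h2⟩⟩)
  obtain ⟨M, hM⟩ : ∃ M, ∀ i, pos i ≤ M := by
    obtain ⟨M, hM⟩ := (Set.finite_range pos).bddAbove
    exact ⟨M, fun i => hM ⟨i, rfl⟩⟩
  have : ∀ i, Nonempty {c // (F i).IsAdapted c} := fun i => nonempty_subtype.2
    (F i).exists_isAdapted
  obtain ⟨c, hc⟩ := exists_compatible_family (fun i => M - pos i)
    (D := fun i => {c // (F i).IsAdapted c}) (fun j i => par i j)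
    (fun j i c' c => (∀ h : i ⟶ j, ∀ p ∈ (F i).jumps, x i j h (c.1 p) = c'.1 p) ∧
      (∀ h : j ⟶ i, ∀ p ∈ (F j).jumps, x j i h (c'.1 p) = c.1 p))
    (fun {j i} h => by have := h.2; have := hM j; have := hM i; lia)
    (fun h h' => hpos.eq_of_isLinked h.1 h'.1 (by have := h.2; have := h'.2; lia))
    (by
      rintro j i hij c'
      have hFij := hF i j hij
      obtain ⟨⟨h | h⟩, -⟩ := hij
      · obtain ⟨c, h1, h2⟩ := (hFij.1 h).2 _ c'.2
        exact ⟨⟨c, h1⟩, fun h' => hsub h h' ▸ h2, fun h' => (hemp h h').elim⟩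
      · obtain ⟨c, h1, h2⟩ := (hFij.2 h).2 _ c'.2
        exact ⟨⟨c, h1⟩, fun h' => (hemp h h').elim, fun h' => hsub h h' ▸ h2⟩)
  have hmap : ∀ {i j : I} (h : i ⟶ j), ∀ p ∈ (F i).jumps, x i j h ((c i).1 p) = (c j).1 p := by
    intro i j h
    rcases hpos.adj h with h1 | h1
    · exact (hc j i ⟨⟨.inl h⟩, h1⟩).1 h
    · exact (hc i j ⟨⟨.inr h⟩, h1⟩).2 h
  have hK : ∀ i p, p ∈ (F i).finite_jumps.toFinset ↔ p ∈ (F i).jumps := fun i p =>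
    Set.Finite.mem_toFinset _
  let b₀ : ∀ i, Module.Basis (F i).jumps ℂ (V i) := fun i =>
    Module.Basis.mk (c i).2.linearIndependent (by
      obtain ⟨t, ht⟩ := (F i).exists_top
      exact ht ▸ (c i).2.step_le_span t)
  let b : ∀ i, Module.Basis (F i).finite_jumps.toFinset ℂ (V i) := fun i =>
    (b₀ i).reindex (Equiv.subtypeEquivRight fun p => (hK i p).symm)
  have hb : ∀ i p, b i p = (c i).1 p := fun i p => by simp [b, b₀]
  refine ⟨⟨fun i => (F i).finite_jumps.toFinset, b, ?_, ?_, ?_, ?_⟩⟩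
  · intro i j h p hp
    rw [hb, hb]
    exact hmap h p ((hK i p).1 p.2)
  · intro i j h p hp
    rw [hb, hmap h p ((hK i p).1 p.2), (c j).2.eq_zero]
    rwa [← hK]
  · intro i j h hij p hp q hq hq'
    rw [hK] at hp hq hq'
    exact ((hF i j ⟨⟨.inl h⟩, hij⟩).1 h).1 p hp q hq hq'
  · intro i j h hij p hp hp' q hq
    rw [hK] at hp hq hp'
    exact ((hF j i ⟨⟨.inr h⟩, hij⟩).2 h).1 p hp hp' q hq

/-! ### Pivots and echelon forms -/

section Echelon

variable {V : Type*} [AddCommGroup V] [Module ℂ V] {K : Finset ℤ} (b : Module.Basis K ℂ V)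

/-- The span of the basis vectors with label at most `k`. -/
def coordStep (k : ℤ) : Submodule ℂ V where
  carrier := {v | ∀ q : K, k < q → b.repr v q = 0}
  add_mem' hu hv q hq := by simp [hu q hq, hv q hq]
  zero_mem' q _ := by simp
  smul_mem' t v hv q hq := by simp [hv q hq]

/-- The pivots of a subspace: the largest labels occurring in its nonzero vectors. -/
def pivots (U : Submodule ℂ V) : Set K :=
  {p | ∃ v ∈ U, v ∈ coordStep b p ∧ b.repr v p ≠ 0}

variable {b}

theorem pivots_mono {U U' : Submodule ℂ V} (h : U ≤ U') : pivots b U ⊆ pivots b U' :=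
  fun _ ⟨v, hv, h'⟩ => ⟨v, h hv, h'⟩

theorem pivots_top : pivots b ⊤ = Set.univ := by
  refine Set.eq_univ_of_forall fun p => ⟨b p, trivial, fun q hq => ?_, by simp⟩
  rw [b.repr_self, Finsupp.single_apply_eq_zero]
  rintro rfl
  exact (lt_irrefl _ hq).elim

/-- A vector of `U` is determined by its coordinates at the pivots. -/
theorem eq_zero_of_pivots {U : Submodule ℂ V} {v : V} (hv : v ∈ U)
    (h : ∀ p ∈ pivots b U, b.repr v p = 0) : v = 0 := by
  classical
  by_contra hne
  have hne' : (b.repr v).support.Nonempty := by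
    rw [Finsupp.support_nonempty_iff]
    simpa using hne
  obtain ⟨p, hp, hmax⟩ := (b.repr v).support.exists_maximal hne'
  rw [Finsupp.mem_support_iff] at hp
  refine hp (h p ⟨v, hv, fun q hq => ?_, hp⟩)
  by_contra hq0
  exact absurd (hmax (Finsupp.mem_support_iff.2 hq0) (le_of_lt hq)) (not_le.2 hq)

/-- Reduced echelon form: each pivot is the leading label of a vector of `U` whose coordinates at
the other pivots vanish. -/
theorem exists_reduced (U : Submodule ℂ V) (p : K) (hp : p ∈ pivots b U) :
    ∃ v ∈ U, v ∈ coordStep b p ∧ b.repr v p = 1 ∧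
      ∀ t ∈ pivots b U, t ≠ p → b.repr v t = 0 := by
  classical
  induction p using WellFoundedLT.induction with
  | ind p ih =>
    obtain ⟨v, hv, hvp, hv0⟩ := hp
    choose! w hw hwp hw1 hw0 using ih
    let s : Finset K := Finset.univ.filter fun t => t ∈ pivots b U ∧ t < p
    have hs : ∀ t, t ∈ s ↔ t ∈ pivots b U ∧ t < p := fun t => by simp [s]
    refine ⟨(b.repr v p)⁻¹ • v - ∑ t ∈ s, ((b.repr v p)⁻¹ * b.repr v t) • w t,
      sub_mem (U.smul_mem _ hv) (U.sum_mem fun t ht => U.smul_mem _ (hw t ((hs t).1 ht).2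
        ((hs t).1 ht).1)), ?_, ?_, ?_⟩
    · refine sub_mem (Submodule.smul_mem _ _ hvp) (Submodule.sum_mem _ fun t ht =>
        Submodule.smul_mem _ _ fun q hq => ?_)
      have ht' := (hs t).1 ht
      exact hwp t ht'.2 ht'.1 q (lt_trans ht'.2 hq)
    · have h1 : ∀ t ∈ s, (b.repr v p)⁻¹ * b.repr v t * b.repr (w t) p = 0 := fun t ht => by
        have ht' := (hs t).1 ht
        rw [hwp t ht'.2 ht'.1 p ht'.2, mul_zero]
      simp [Finset.sum_eq_zero h1, hv0]
    · intro q hq hqp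
      rcases lt_or_gt_of_ne hqp with h | h
      · have h1 : ∀ t ∈ s, t ≠ q → (b.repr v p)⁻¹ * b.repr v t * b.repr (w t) q = 0 :=
          fun t ht htq => by
            have ht' := (hs t).1 ht
            rw [hw0 t ht'.2 ht'.1 q hq htq.symm, mul_zero]
        have h2 : q ∈ s := (hs q).2 ⟨hq, h⟩
        simp only [map_sub, map_smul, map_sum, Finsupp.sub_apply, Finsupp.smul_apply, smul_eq_mul,
          Finsupp.finsetSum_apply]
        rw [Finset.sum_eq_single_of_mem q h2 h1, hw1 q h hq, mul_one, sub_self]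
      · have h1 : ∀ t ∈ s, (b.repr v p)⁻¹ * b.repr v t * b.repr (w t) q = 0 := fun t ht => by
          have ht' := (hs t).1 ht
          rw [hwp t ht'.2 ht'.1 q (lt_trans ht'.2 h), mul_zero]
        simp [Finset.sum_eq_zero h1, hvp q h]

open Classical in
theorem finrank_inf_coordStep (U : Submodule ℂ V) (k : ℤ) :
    Module.finrank ℂ (U ⊓ coordStep b k : Submodule ℂ V) =
      (Finset.univ.filter fun p : K => p ∈ pivots b U ∧ (p : ℤ) ≤ k).card := by
  have h : Module.finrank ℂ (U ⊓ coordStep b k : Submodule ℂ V) =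
      Module.finrank ℂ ({p : K // p ∈ pivots b U ∧ (p : ℤ) ≤ k} → ℂ) := by
    let f : (U ⊓ coordStep b k : Submodule ℂ V) →ₗ[ℂ]
        ({p : K // p ∈ pivots b U ∧ (p : ℤ) ≤ k} → ℂ) :=
      LinearMap.pi fun p => b.coord p.1 ∘ₗ Submodule.subtype _
    refine (LinearEquiv.ofBijective f ⟨?_, ?_⟩).finrank_eq
    · refine (injective_iff_map_eq_zero f).2 fun v hv => Subtype.ext ?_
      refine eq_zero_of_pivots (b := b) v.2.1 fun p hp => ?_
      rcases le_or_gt (p : ℤ) k with h | h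
      · exact congrFun hv ⟨p, hp, h⟩
      · exact v.2.2 p h
    · intro a
      choose w hw hwp hw1 hw0 using exists_reduced (b := b) U
      refine ⟨⟨∑ p : {p : K // p ∈ pivots b U ∧ (p : ℤ) ≤ k}, a p • w p.1 p.2.1,
        Submodule.sum_mem _ fun p _ => Submodule.smul_mem _ _ ⟨hw _ _, fun q hq =>
          hwp _ _ q (p.2.2.trans_lt hq)⟩⟩, ?_⟩
      funext t
      simp only [f, LinearMap.pi_apply, LinearMap.comp_apply, Submodule.subtype_apply, map_sum,
        map_smul, smul_eq_mul, Module.Basis.coord_apply]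
      rw [Finset.sum_eq_single t, hw1, mul_one]
      · intro p _ hpt
        rw [hw0 _ _ t.1 t.2.1 fun h => hpt (Subtype.ext h.symm), mul_zero]
      · simp
  rw [h, Module.finrank_fintype_fun_eq_card, Fintype.card_subtype]

open Classical in
theorem finrank_eq_card_pivots (U : Submodule ℂ V) :
    Module.finrank ℂ U = (Finset.univ.filter fun p : K => p ∈ pivots b U).card := by
  obtain ⟨k, hk⟩ : ∃ k, ∀ p ∈ K, p ≤ k := by
    obtain ⟨k, hk⟩ := K.bddAbove
    exact ⟨k, fun p hp => hk hp⟩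
  have h1 : coordStep b k = ⊤ := top_le_iff.1 fun v _ q hq => absurd (hk q q.2) (not_le.2 hq)
  have h2 := finrank_inf_coordStep (b := b) U k
  rw [h1, inf_top_eq] at h2
  rw [h2]
  congr 1
  ext p
  simp [hk p p.2]

/-- The pivots are the jumps of the dimension of the intersection with the coordinate flag. -/
theorem mem_pivots_iff (U : Submodule ℂ V) (p : K) :
    p ∈ pivots b U ↔ Module.finrank ℂ (U ⊓ coordStep b p : Submodule ℂ V) ≠
      Module.finrank ℂ (U ⊓ coordStep b (p - 1) : Submodule ℂ V) := by
  classical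
  rw [finrank_inf_coordStep, finrank_inf_coordStep]
  constructor
  · intro hp
    refine (Finset.card_lt_card ⟨fun q hq => ?_, fun h => ?_⟩).ne'
    · simp only [Finset.mem_filter, Finset.mem_univ, true_and] at hq ⊢
      exact ⟨hq.1, by lia⟩
    · have h1 := h (x := p) (by simp [hp])
      simp at h1
  · intro h
    by_contra hp
    refine h (congrArg Finset.card ?_)
    ext q
    simp only [Finset.mem_filter, Finset.mem_univ, true_and]
    refine and_congr_right fun hq => ?_
    have : (q : ℤ) ≠ p := fun h => hp (Subtype.ext h ▸ hq)
    lia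

/-- A unitriangular matrix: `1` on the diagonal, and zero below it. -/
structure IsUnitriangular (u : Matrix K K ℂ) : Prop where
  diag : ∀ p, u p p = 1
  eq_zero : ∀ q p, p < q → u q p = 0

theorem IsUnitriangular.det_eq_one {u : Matrix K K ℂ} (hu : IsUnitriangular u) : u.det = 1 := by
  rw [Matrix.det_of_isUpperTriangular fun q p h => hu.eq_zero q p h]
  exact Finset.prod_eq_one fun p _ => hu.diag p

theorem IsUnitriangular.isUnit_det {u : Matrix K K ℂ} (hu : IsUnitriangular u) :
    IsUnit u.det := by
  rw [hu.det_eq_one]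
  exact isUnit_one

theorem IsUnitriangular.inv_eq_adjugate {u : Matrix K K ℂ} (hu : IsUnitriangular u) :
    u⁻¹ = u.adjugate := by
  rw [Matrix.inv_def, hu.det_eq_one, Ring.inverse_one, one_smul]

variable (b) in
/-- The vector whose coordinates are given by a column of a matrix. -/
noncomputable def columnVec (u : Matrix K K ℂ) (p : K) : V := ∑ q, u q p • b q

theorem repr_columnVec (u : Matrix K K ℂ) (p q : K) : b.repr (columnVec b u p) q = u q p := by
  classical
  simp [columnVec, Finsupp.single_apply]

theorem columnVec_mem_coordStep {u : Matrix K K ℂ} (hu : IsUnitriangular u) (p : K) :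
    columnVec b u p ∈ coordStep b p := fun q hq => by
  rw [repr_columnVec]
  exact hu.eq_zero q p hq

theorem eq_columnVec {u : Matrix K K ℂ} {p : K} {v : V} (h : ∀ q, b.repr v q = u q p) :
    v = columnVec b u p :=
  b.repr.injective (Finsupp.ext fun q => by rw [repr_columnVec, h])

/-- The expansion of a vector in the basis formed by the columns of an invertible matrix. -/
theorem eq_sum_columnVec {u : Matrix K K ℂ} (hu : IsUnit u.det) (v : V) :
    v = ∑ q, (u⁻¹.mulVec (b.repr v)) q • columnVec b u q := by
  apply b.repr.injective
  ext q
  have h1 : ∑ x, (u⁻¹.mulVec (b.repr v)) x * u q x = (u.mulVec (u⁻¹.mulVec (b.repr v))) q := by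
    simp [Matrix.mulVec, dotProduct, mul_comm]
  simp only [map_sum, map_smul, Finsupp.finsetSum_apply, Finsupp.smul_apply, repr_columnVec,
    smul_eq_mul]
  rw [h1, Matrix.mulVec_mulVec, Matrix.mul_nonsing_inv _ hu, Matrix.one_mulVec]

theorem linearIndependent_columnVec {u : Matrix K K ℂ} (hu : IsUnit u.det) :
    LinearIndependent ℂ (columnVec b u) := by
  rw [Fintype.linearIndependent_iff]
  intro g hg p
  have h1 : u.mulVec g = 0 := by
    ext q
    have := congrArg (fun v => b.repr v q) hg
    simp only [map_sum, map_smul, Finsupp.finsetSum_apply, Finsupp.smul_apply, repr_columnVec,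
      smul_eq_mul, map_zero, Finsupp.zero_apply] at this
    simpa [Matrix.mulVec, dotProduct, mul_comm] using this
  have h2 : g = 0 := Matrix.mulVec_injective_iff_isUnit.2
    ((Matrix.isUnit_iff_isUnit_det _).2 hu) (h1.trans (Matrix.mulVec_zero _).symm)
  rw [h2, Pi.zero_apply]

/-- The span of the columns of a matrix with labels in a set `P`. -/
noncomputable def columnSpan (b : Module.Basis K ℂ V) (u : Matrix K K ℂ) (P : Set K) :
    Submodule ℂ V :=
  Submodule.span ℂ (Set.range fun p : P => columnVec b u p)

theorem columnVec_mem_columnSpan {u : Matrix K K ℂ} {P : Set K} {p : K} (hp : p ∈ P) :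
    columnVec b u p ∈ columnSpan b u P := Submodule.subset_span ⟨⟨p, hp⟩, rfl⟩

theorem columnSpan_mono {u : Matrix K K ℂ} {P Q : Set K} (h : P ⊆ Q) :
    columnSpan b u P ≤ columnSpan b u Q := by
  refine Submodule.span_le.2 ?_
  rintro _ ⟨p, rfl⟩
  exact columnVec_mem_columnSpan (h p.2)

open Classical in
theorem finrank_columnSpan {u : Matrix K K ℂ} (hu : IsUnit u.det) (P : Set K) :
    Module.finrank ℂ (columnSpan b u P) = (Finset.univ.filter fun p : K => p ∈ P).card := by
  have h : LinearIndependent ℂ (fun p : P => columnVec b u p) :=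
    (linearIndependent_columnVec hu).comp _ Subtype.val_injective
  rw [columnSpan, finrank_span_eq_card h, Fintype.card_subtype]

theorem mem_columnSpan_iff {u : Matrix K K ℂ} (hu : IsUnit u.det) {P : Set K} {v : V} :
    v ∈ columnSpan b u P ↔ ∀ q ∉ P, (u⁻¹.mulVec (b.repr v)) q = 0 := by
  classical
  constructor
  · intro hv q hq
    rw [columnSpan, Submodule.mem_span_range_iff_exists_fun] at hv
    obtain ⟨c, rfl⟩ := hv
    have h1 : ∀ p : K, ⇑(b.repr (columnVec b u p)) = u.mulVec (Pi.single p 1) := fun p => by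
      ext t
      simp [repr_columnVec]
    simp only [map_sum, map_smul, Finsupp.coe_finsetSum, Finsupp.coe_smul, h1,
      Matrix.mulVec_sum, Matrix.mulVec_smul, Matrix.mulVec_mulVec, Matrix.nonsing_inv_mul _ hu,
      Matrix.one_mulVec, Finset.sum_apply, Pi.smul_apply, smul_eq_mul]
    refine Finset.sum_eq_zero fun p _ => ?_
    rw [Pi.single_eq_of_ne (by rintro rfl; exact hq p.2), mul_zero]
  · intro h
    rw [eq_sum_columnVec hu v]
    refine Submodule.sum_mem _ fun q _ => ?_
    by_cases hq : q ∈ P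
    · exact Submodule.smul_mem _ _ (columnVec_mem_columnSpan hq)
    · rw [h q hq, zero_smul]
      exact zero_mem _

theorem pivots_columnSpan {u : Matrix K K ℂ} (hu : IsUnitriangular u) (P : Set K) :
    pivots b (columnSpan b u P) = P := by
  classical
  have h1 : P ⊆ pivots b (columnSpan b u P) := fun p hp =>
    ⟨columnVec b u p, columnVec_mem_columnSpan hp, columnVec_mem_coordStep hu p, by
      rw [repr_columnVec, hu.diag]
      exact one_ne_zero⟩
  have h2 := (finrank_eq_card_pivots (b := b) (columnSpan b u P)).symm.trans
    (finrank_columnSpan hu.isUnit_det P)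
  have h3 := Finset.eq_of_subset_of_card_le (s := Finset.univ.filter fun p : K => p ∈ P)
    (t := Finset.univ.filter fun p : K => p ∈ pivots b (columnSpan b u P))
    (fun p hp => by simpa using h1 (by simpa using hp)) h2.le
  ext p
  simpa using (Finset.ext_iff.1 h3 p).symm

/-- An increasing family of subspaces such that `p` is a pivot of the `r`-th one if and only if
`ρ p ≤ r` is given by the columns of a unique unitriangular matrix `u` such that `u q p = 0` for
`q ≠ p` with `ρ q ≤ ρ p`: the columns form the reduced echelon forms of the subspaces. -/
theorem exists_unitriangular_of_pivots {n : ℕ} {U : Fin n → Submodule ℂ V} (hU : Monotone U)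
    {ρ : K → Fin n} (hρ : ∀ r p, p ∈ pivots b (U r) ↔ ρ p ≤ r) :
    ∃ u : Matrix K K ℂ, IsUnitriangular u ∧ (∀ q p, q ≠ p → ρ q ≤ ρ p → u q p = 0) ∧
      ∀ r, U r = columnSpan b u {p | ρ p ≤ r} := by
  classical
  choose w hw hwp hw1 hw0 using fun p => exists_reduced (b := b) (U (ρ p)) p ((hρ _ _).2 le_rfl)
  have hu : IsUnitriangular (Matrix.of fun q p => b.repr (w p) q) :=
    ⟨fun p => hw1 p, fun q p hpq => hwp p q hpq⟩
  refine ⟨Matrix.of fun q p => b.repr (w p) q, hu,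
    fun q p hqp h => hw0 p q ((hρ _ _).2 h) hqp, fun r => ?_⟩
  have := b.finiteDimensional_of_finite
  refine (Submodule.eq_of_le_of_finrank_eq ?_ ?_).symm
  · refine Submodule.span_le.2 ?_
    rintro _ ⟨p, rfl⟩
    have h1 : w p = columnVec b (Matrix.of fun q p => b.repr (w p) q) p :=
      eq_columnVec fun q => rfl
    change columnVec b _ p.1 ∈ U r
    rw [← h1]
    exact hU p.2 (hw p)
  · rw [finrank_columnSpan hu.isUnit_det, finrank_eq_card_pivots (b := b) (U r)]
    congr 1
    ext p
    simp [hρ]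

end Echelon

/-! ### Triangular systems of polynomial equations -/

/-- The solutions of a triangular system `c v = G v c`, `v ∉ free`, in which the polynomial `G v`
involves only unknowns of smaller rank than `v`, are parametrized polynomially by the values of the
free unknowns. -/
theorem exists_triangular_parametrization {ι : Type*} [Finite ι] (rank : ι → ℕ) (free : Set ι)
    (G : ι → (ι → ℂ) → ℂ) (hG : ∀ v, v ∉ free → G v ∈ polyFunctions (ι → ℂ))
    (hdep : ∀ v, v ∉ free → ∀ c c' : ι → ℂ, (∀ w, rank w < rank v → c w = c' w) →
      G v c = G v c') :
    ∃ (n : ℕ) (e : Fin n → ι) (s : (Fin n → ℂ) → ι → ℂ),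
      (∀ t, e t ∈ free) ∧
      (∀ v, (fun z => s z v) ∈ polyFunctions (Fin n → ℂ)) ∧ (∀ z t, s z (e t) = z t) ∧
      (∀ z, ∀ v ∉ free, s z v = G v (s z)) ∧
      ∀ c, (∀ v ∉ free, c v = G v c) → s (fun t => c (e t)) = c := by
  classical
  obtain ⟨n, ⟨e⟩⟩ := Finite.exists_equiv_fin free
  let Φ : (Fin n → ℂ) → ∀ v, (∀ w, rank w < rank v → ℂ) → ℂ := fun z v rec =>
    if h : v ∈ free then z (e ⟨v, h⟩)
    else G v (fun w => if hw : rank w < rank v then rec w hw else 0)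
  let s : (Fin n → ℂ) → ι → ℂ := fun z => (measure rank).wf.fix (Φ z)
  have hs : ∀ z v, s z v = if h : v ∈ free then z (e ⟨v, h⟩)
      else G v (fun w => if rank w < rank v then s z w else 0) := by
    intro z v
    have h1 : s z v = Φ z v fun w _ => s z w := (measure rank).wf.fix_eq (Φ z) v
    rw [h1]
    simp [Φ]
  clear_value s
  refine ⟨n, fun t => (e.symm t).1, s, fun t => (e.symm t).2, ?_, ?_, ?_, ?_⟩
  · intro v
    induction v using (measure rank).wf.induction with
    | h v ih =>
      by_cases hv : v ∈ free
      · have : (fun z => s z v) = fun z => z (e ⟨v, hv⟩) := by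
          ext z
          rw [hs, dif_pos hv]
        rw [this]
        exact coord_mem_polyFunctions _
      · have : (fun z => s z v) =
            fun z => G v (fun w => if rank w < rank v then s z w else 0) := by
          ext z
          rw [hs, dif_neg hv]
        rw [this]
        refine IsPolyMap.comp_mem (isPolyMap_pi fun w => ?_) (hG v hv)
        by_cases hw : rank w < rank v
        · simpa [hw] using isPolyMap_smul (ih w hw) (1 : ℂ)
        · simpa [hw] using isPolyMap_const (0 : ℂ)
  · intro z t
    rw [hs, dif_pos (e.symm t).2]
    simp
  · intro z v hv
    rw [hs, dif_neg hv]
    exact hdep v hv _ _ fun w hw => by rw [if_pos hw]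
  · intro c hc
    funext v
    induction v using (measure rank).wf.induction with
    | h v ih =>
      by_cases hv : v ∈ free
      · refine (hs _ v).trans ?_
        rw [dif_pos hv]
        simp
      · refine (hs _ v).trans ?_
        rw [dif_neg hv, hc v hv]
        refine hdep v hv _ _ fun w hw => ?_
        rw [if_pos hw]
        exact ih w hw

/-! ### Inverses of unitriangular matrices -/

namespace IsUnitriangular

variable {K : Finset ℤ} {u u' : Matrix K K ℂ}

theorem inv_apply (hu : IsUnitriangular u) (q p : K) :
    u⁻¹ q p = (if q = p then 1 else 0) - ∑ a with a < p, u⁻¹ q a * u a p := by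
  have h1 : (u⁻¹ * u) q p = if q = p then 1 else 0 := by
    rw [Matrix.nonsing_inv_mul _ hu.isUnit_det, Matrix.one_apply]
  rw [← h1, Matrix.mul_apply, ← Finset.sum_filter_add_sum_filter_not Finset.univ (· < p),
    add_sub_cancel_left, Finset.sum_eq_single p]
  · rw [hu.diag, mul_one]
  · intro a ha hap
    have h2 : p < a := lt_of_le_of_ne (not_lt.1 (by simpa using ha)) hap.symm
    rw [hu.eq_zero _ _ h2, mul_zero]
  · simp

theorem inv (hu : IsUnitriangular u) : IsUnitriangular u⁻¹ := by
  have h0 : ∀ q p, p < q → u⁻¹ q p = 0 := by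
    intro q p
    induction p using WellFoundedLT.induction with
    | ind p ih =>
      intro hpq
      rw [hu.inv_apply, if_neg hpq.ne', zero_sub, neg_eq_zero]
      refine Finset.sum_eq_zero fun a ha => ?_
      have ha' : a < p := by simpa using ha
      rw [ih a ha' (ha'.trans hpq), zero_mul]
  refine ⟨fun p => ?_, h0⟩
  rw [hu.inv_apply, if_pos rfl, Finset.sum_eq_zero, sub_zero]
  intro a ha
  rw [h0 p a (by simpa using ha), zero_mul]

/-- The entries of length less than `d` of the inverse depend only on such entries of the matrix. -/
theorem inv_congr (hu : IsUnitriangular u) (hu' : IsUnitriangular u') {d : ℤ}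
    (h : ∀ q p : K, (p : ℤ) - q < d → u q p = u' q p) (q p : K) (hqp : (p : ℤ) - q < d) :
    u⁻¹ q p = u'⁻¹ q p := by
  induction p using WellFoundedLT.induction with
  | ind p ih =>
    rw [hu.inv_apply, hu'.inv_apply]
    congr 1
    refine Finset.sum_congr rfl fun a ha => ?_
    have ha' : a < p := by simpa using ha
    have ha'' : (a : ℤ) < p := ha'
    rcases lt_or_ge a q with haq | haq
    · rw [hu.inv.eq_zero _ _ haq, hu'.inv.eq_zero _ _ haq, zero_mul, zero_mul]
    · have haq' : (q : ℤ) ≤ a := haq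
      rw [ih a ha' (by lia), h a p (by lia)]

/-- Up to entries of smaller length, the inverse is the negative of the matrix. -/
theorem inv_add_congr (hu : IsUnitriangular u) (hu' : IsUnitriangular u') {q p : K} (hqp : q < p)
    (h : ∀ a c : K, (c : ℤ) - a < p - q → u a c = u' a c) :
    u⁻¹ q p + u q p = u'⁻¹ q p + u' q p := by
  have key : ∀ {w : Matrix K K ℂ}, IsUnitriangular w →
      w⁻¹ q p + w q p = -∑ a ∈ (Finset.univ.filter (· < p)).erase q, w⁻¹ q a * w a p := by
    intro w hw
    rw [hw.inv_apply, if_neg hqp.ne, ← Finset.add_sum_erase _ _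
      (show q ∈ Finset.univ.filter (· < p) by simpa using hqp), hw.inv.diag]
    ring
  rw [key hu, key hu']
  congr 1
  refine Finset.sum_congr rfl fun a ha => ?_
  have ha' : a ≠ q ∧ a < p := by simpa using ha
  have ha'' : (a : ℤ) < p := ha'.2
  rcases lt_or_ge a q with haq | haq
  · rw [hu.inv.eq_zero _ _ haq, hu'.inv.eq_zero _ _ haq, zero_mul, zero_mul]
  · have haq' : (q : ℤ) < a := lt_of_le_of_ne haq fun h => ha'.1 (Subtype.ext h.symm)
    rw [hu.inv_congr hu' h q a (by lia), h a p (by lia)]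

end IsUnitriangular

/-! ### The equations of a stratum -/

section Stratum

variable {I : Type*} [Quiver.{v + 1} I] {pos : I → ℕ} {V : I → Type*}
  [∀ i, AddCommGroup (V i)] [∀ i, Module ℂ (V i)] {x : QuiverRep V}

namespace AdaptedBases

variable (A : AdaptedBases pos x) {m : ℕ} (ρ : ∀ i, A.K i → Fin m)

/-- The index set of the unknowns: the pairs of labels at each vertex. -/
abbrev Var : Type _ := Σ i, A.K i × A.K i

variable {A} in
/-- The unknowns which are not zero by convention: those above the diagonal, in the positions of
a reduced echelon form. -/
def IsAllowed (i : I) (q p : A.K i) : Prop := q < p ∧ ρ i p < ρ i q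

open Classical in
variable {A} in
/-- The unitriangular matrices formed by the unknowns. -/
noncomputable def unknownMatrix (c : A.Var → ℂ) (i : I) : Matrix (A.K i) (A.K i) ℂ :=
  fun q p => if q = p then 1 else if IsAllowed ρ i q p then c ⟨i, q, p⟩ else 0

/-- The matrix in the adapted bases of an arrow from `i` to `j`. -/
noncomputable def labelMatrix (i j : I) : Matrix (A.K j) (A.K i) ℂ :=
  fun a b => if (a : ℤ) = b then 1 else 0

/-- The matrix of an arrow from `i` to `j` in the bases formed by the columns of the matrices of
unknowns. -/
noncomputable def arrowMatrix (c : A.Var → ℂ) (i j : I) : Matrix (A.K j) (A.K i) ℂ :=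
  (unknownMatrix ρ c j)⁻¹ * A.labelMatrix i j * unknownMatrix ρ c i

variable {ρ} {A}

theorem isUnitriangular_unknownMatrix (c : A.Var → ℂ) (i : I) :
    IsUnitriangular (unknownMatrix ρ c i) := by
  refine ⟨fun p => by simp [unknownMatrix], fun q p hpq => ?_⟩
  rw [unknownMatrix, if_neg hpq.ne', if_neg fun h => lt_asymm h.1 hpq]

theorem unknownMatrix_of_isAllowed {c : A.Var → ℂ} {i : I} {q p : A.K i}
    (h : IsAllowed ρ i q p) : unknownMatrix ρ c i q p = c ⟨i, q, p⟩ := by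
  rw [unknownMatrix, if_neg h.1.ne, if_pos h]

theorem unknownMatrix_congr {c c' : A.Var → ℂ} {i : I} {q p : A.K i}
    (h : q < p → c ⟨i, q, p⟩ = c' ⟨i, q, p⟩) :
    unknownMatrix ρ c i q p = unknownMatrix ρ c' i q p := by
  by_cases hqp : IsAllowed ρ i q p
  · rw [unknownMatrix_of_isAllowed hqp, unknownMatrix_of_isAllowed hqp, h hqp.1]
  · simp only [unknownMatrix, if_neg hqp]

theorem arrowMatrix_apply (c : A.Var → ℂ) (i j : I) (q : A.K j) (p : A.K i) :
    A.arrowMatrix ρ c i j q p = ∑ ab : A.K j × A.K i, (unknownMatrix ρ c j)⁻¹ q ab.1 *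
      (A.labelMatrix i j ab.1 ab.2 * unknownMatrix ρ c i ab.2 p) := by
  rw [Fintype.sum_prod_type, arrowMatrix, Matrix.mul_assoc, Matrix.mul_apply]
  refine Finset.sum_congr rfl fun a _ => ?_
  rw [Matrix.mul_apply, Finset.mul_sum]

theorem arrowMatrix_eq_zero_of_lt (c : A.Var → ℂ) {i j : I} {q : A.K j} {p : A.K i}
    (h : (p : ℤ) < q) : A.arrowMatrix ρ c i j q p = 0 := by
  rw [arrowMatrix_apply]
  refine Finset.sum_eq_zero fun ⟨a, b⟩ _ => ?_
  rcases lt_or_ge a q with haq | haq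
  · rw [(isUnitriangular_unknownMatrix c j).inv.eq_zero _ _ haq, zero_mul]
  · have haq' : (q : ℤ) ≤ a := haq
    by_cases hab : (a : ℤ) = b
    · rw [(isUnitriangular_unknownMatrix c i).eq_zero b p (show (p : ℤ) < b by lia), mul_zero,
        mul_zero]
    · rw [labelMatrix, if_neg hab, zero_mul, mul_zero]

theorem unknownMatrix_mem_polyFunctions [Finite I] (i : I) (q p : A.K i) :
    (fun c : A.Var → ℂ => unknownMatrix ρ c i q p) ∈ polyFunctions (A.Var → ℂ) := by
  by_cases hqp : q = p
  · simpa [unknownMatrix, hqp] using const_mem_polyFunctions (1 : ℂ)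
  · by_cases h : IsAllowed ρ i q p
    · simp only [unknownMatrix, if_neg hqp, if_pos h]
      exact coord_mem_polyFunctions _
    · simpa [unknownMatrix, hqp, h] using const_mem_polyFunctions (0 : ℂ)

theorem arrowMatrix_mem_polyFunctions [Finite I] (i j : I) (q : A.K j) (p : A.K i) :
    (fun c : A.Var → ℂ => A.arrowMatrix ρ c i j q p) ∈ polyFunctions (A.Var → ℂ) := by
  simp only [arrowMatrix_apply, (isUnitriangular_unknownMatrix _ j).inv_eq_adjugate]
  refine sum_mem_polyFunctions _ fun ab _ => mul_mem ?_ (mul_mem (const_mem_polyFunctions _) ?_)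
  · exact adjugate_mem_polyFunctions (fun a b => unknownMatrix_mem_polyFunctions j a b) _ _
  · exact unknownMatrix_mem_polyFunctions _ _ _

/-- For an arrow to the right, the entry `(q, p)` of its matrix is the unknown `(q, p)` at its
source, up to unknowns of smaller length at its source and unknowns at its target of at most the
same length. -/
theorem arrowMatrix_sub_congr_source {c c' : A.Var → ℂ} {i j : I} {q p : A.K i} {q' : A.K j}
    (hq : (q' : ℤ) = q) (hqp : IsAllowed ρ i q p)
    (hi : ∀ a b : A.K i, (b : ℤ) - a < p - q → c ⟨i, a, b⟩ = c' ⟨i, a, b⟩)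
    (hj : ∀ a b : A.K j, (b : ℤ) - a ≤ p - q → c ⟨j, a, b⟩ = c' ⟨j, a, b⟩) :
    c ⟨i, q, p⟩ - A.arrowMatrix ρ c i j q' p = c' ⟨i, q, p⟩ - A.arrowMatrix ρ c' i j q' p := by
  classical
  have key : ∀ c : A.Var → ℂ, c ⟨i, q, p⟩ - A.arrowMatrix ρ c i j q' p =
      -∑ ab ∈ Finset.univ.erase (q', q), (unknownMatrix ρ c j)⁻¹ q' ab.1 *
        (A.labelMatrix i j ab.1 ab.2 * unknownMatrix ρ c i ab.2 p) := by
    intro c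
    rw [arrowMatrix_apply, ← Finset.add_sum_erase _ _ (Finset.mem_univ (q', q)),
      (isUnitriangular_unknownMatrix c j).inv.diag, labelMatrix, if_pos hq,
      unknownMatrix_of_isAllowed hqp]
    ring
  rw [key, key]
  congr 1
  refine Finset.sum_congr rfl fun ⟨a, b⟩ hab => ?_
  have hne : ¬ (a = q' ∧ b = q) := by simpa using hab
  by_cases hab' : (a : ℤ) = b
  swap
  · simp [labelMatrix, hab']
  rcases lt_or_ge a q' with haq | haq
  · rw [(isUnitriangular_unknownMatrix c j).inv.eq_zero _ _ haq,
      (isUnitriangular_unknownMatrix c' j).inv.eq_zero _ _ haq, zero_mul, zero_mul]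
  have haq' : (q' : ℤ) ≤ a := haq
  have haq'' : (q' : ℤ) ≠ a := fun h =>
    hne ⟨Subtype.ext h.symm, Subtype.ext (by rw [← hab', ← h, hq])⟩
  rcases lt_or_ge p b with hbp | hbp
  · rw [(isUnitriangular_unknownMatrix c i).eq_zero _ _ hbp,
      (isUnitriangular_unknownMatrix c' i).eq_zero _ _ hbp, mul_zero, mul_zero, mul_zero]
  have hbp' : (b : ℤ) ≤ p := hbp
  rw [(isUnitriangular_unknownMatrix c j).inv_congr (isUnitriangular_unknownMatrix c' j)
      (d := p - q + 1) (fun s t hst => unknownMatrix_congr fun _ => hj s t (by lia)) q' a (by lia),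
    unknownMatrix_congr (c := c) fun _ => hi b p (by lia)]

/-- For an arrow to the left, the entry `(q, p)` of its matrix is the negative of the unknown
`(q, p)` at its target, up to unknowns of smaller length at its target and unknowns at its source
of at most the same length. -/
theorem arrowMatrix_add_congr_target {c c' : A.Var → ℂ} {i j : I} {q p : A.K i} {p' : A.K j}
    (hp : (p' : ℤ) = p) (hqp : IsAllowed ρ i q p)
    (hi : ∀ a b : A.K i, (b : ℤ) - a < p - q → c ⟨i, a, b⟩ = c' ⟨i, a, b⟩)
    (hj : ∀ a b : A.K j, (b : ℤ) - a ≤ p - q → c ⟨j, a, b⟩ = c' ⟨j, a, b⟩) :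
    c ⟨i, q, p⟩ + A.arrowMatrix ρ c j i q p' = c' ⟨i, q, p⟩ + A.arrowMatrix ρ c' j i q p' := by
  classical
  have key : ∀ c : A.Var → ℂ, c ⟨i, q, p⟩ + A.arrowMatrix ρ c j i q p' =
      ((unknownMatrix ρ c i)⁻¹ q p + unknownMatrix ρ c i q p) +
      ∑ ab ∈ Finset.univ.erase (p, p'), (unknownMatrix ρ c i)⁻¹ q ab.1 *
        (A.labelMatrix j i ab.1 ab.2 * unknownMatrix ρ c j ab.2 p') := by
    intro c
    rw [arrowMatrix_apply, ← Finset.add_sum_erase _ _ (Finset.mem_univ (p, p')),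
      (isUnitriangular_unknownMatrix c j).diag, labelMatrix, if_pos hp.symm,
      unknownMatrix_of_isAllowed hqp]
    ring
  rw [key, key, (isUnitriangular_unknownMatrix c i).inv_add_congr
    (isUnitriangular_unknownMatrix c' i) hqp.1
    (fun s t hst => unknownMatrix_congr fun _ => hi s t hst)]
  congr 1
  refine Finset.sum_congr rfl fun ⟨a, b⟩ hab => ?_
  have hne : ¬ (a = p ∧ b = p') := by simpa using hab
  by_cases hab' : (a : ℤ) = b
  swap
  · simp [labelMatrix, hab']
  rcases lt_or_ge a q with haq | haq
  · rw [(isUnitriangular_unknownMatrix c i).inv.eq_zero _ _ haq,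
      (isUnitriangular_unknownMatrix c' i).inv.eq_zero _ _ haq, zero_mul, zero_mul]
  have haq' : (q : ℤ) ≤ a := haq
  have hap : (a : ℤ) ≠ p := fun h =>
    hne ⟨Subtype.ext h, Subtype.ext (by rw [← hab', h, hp])⟩
  rcases lt_or_ge p' b with hbp | hbp
  · rw [(isUnitriangular_unknownMatrix c j).eq_zero _ _ hbp,
      (isUnitriangular_unknownMatrix c' j).eq_zero _ _ hbp, mul_zero, mul_zero, mul_zero]
  have hbp' : (b : ℤ) ≤ p' := hbp
  rw [(isUnitriangular_unknownMatrix c i).inv_congr (isUnitriangular_unknownMatrix c' i)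
      (d := p - q) (fun s t hst => unknownMatrix_congr fun _ => hi s t hst) q a (by lia),
    unknownMatrix_congr (c := c) fun _ => hj b p' (by lia)]

end AdaptedBases

end Stratum

section Stratum

variable {I : Type*} [Quiver.{v + 1} I] {pos : I → ℕ} {V : I → Type*}
  [∀ i, AddCommGroup (V i)] [∀ i, Module ℂ (V i)] {x : QuiverRep V}

namespace AdaptedBases

variable {A : AdaptedBases pos x} {m : ℕ} {ρ : ∀ i, A.K i → Fin m}

/-- The equations of the stratum given by `ρ`: the unknowns which are not allowed vanish, and each
arrow preserves the flags given by the matrices of unknowns (`mapsTo_columnSpan_iff`). -/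
def IsSolution (ρ : ∀ i, A.K i → Fin m) (c : A.Var → ℂ) : Prop :=
  (∀ i q p, ¬ IsAllowed ρ i q p → c ⟨i, q, p⟩ = 0) ∧
    ∀ i j, (i ⟶ j) → ∀ (q : A.K j) (p : A.K i), ρ i p < ρ j q → A.arrowMatrix ρ c i j q p = 0

/-- The part of the equations of a stratum which is used to determine the unknown `(q, p)` at the
vertex `i`: those of an arrow between `i` and the vertex at its right. -/
def IsSolutionAt (ρ : ∀ i, A.K i → Fin m) (c : A.Var → ℂ) (v : A.Var) : Prop :=
  (¬ IsAllowed ρ v.1 v.2.1 v.2.2 → c v = 0) ∧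
  (∀ j, (v.1 ⟶ j) → pos j = pos v.1 + 1 → ∀ q : A.K j, (q : ℤ) = v.2.1 → ρ v.1 v.2.2 < ρ j q →
    v.2.1 < v.2.2 → A.arrowMatrix ρ c v.1 j q v.2.2 = 0) ∧
  (∀ j, (j ⟶ v.1) → pos j = pos v.1 + 1 → ∀ p : A.K j, (p : ℤ) = v.2.2 → ρ j p < ρ v.1 v.2.1 →
    v.2.1 < v.2.2 → A.arrowMatrix ρ c j v.1 v.2.1 p = 0)

/-- Because of the order of the labels, each equation of the stratum which is not automatic
determines an unknown at the left end of an arrow. -/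
theorem isSolution_iff (hpos : IsLinePosition pos)
    (hρ : ∀ {i j : I}, (i ⟶ j) → ∀ (p : A.K i) (p' : A.K j), (p' : ℤ) = p → ρ j p' ≤ ρ i p)
    (c : A.Var → ℂ) : IsSolution ρ c ↔ ∀ v, IsSolutionAt ρ c v := by
  constructor
  · rintro ⟨h1, h2⟩ ⟨i, q, p⟩
    exact ⟨h1 i q p, fun j h _ q' _ hq _ => h2 i j h q' p hq,
      fun j h _ p' _ hp _ => h2 j i h q p' hp⟩
  · intro hv
    refine ⟨fun i q p => (hv ⟨i, q, p⟩).1, fun i j h q p hqp => ?_⟩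
    rcases lt_trichotomy (p : ℤ) q with hlt | heq | hgt
    · exact arrowMatrix_eq_zero_of_lt c hlt
    · exact absurd (hρ h p q heq.symm) (not_le.2 hqp)
    · rcases hpos.adj h with hij | hij
      · have hq : (q : ℤ) ∈ A.K i := by
          by_contra hq
          exact absurd (A.lt_of_right h hij p p.2 q q.2 hq) (not_lt.2 hgt.le)
        exact (hv ⟨i, ⟨q, hq⟩, p⟩).2.1 j h hij q rfl hqp hgt
      · have hp : (p : ℤ) ∈ A.K j := by
          by_contra hp
          exact absurd (A.lt_of_left h hij p p.2 hp q q.2) (not_lt.2 hgt.le)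
        exact (hv ⟨j, q, ⟨p, hp⟩⟩).2.2 i h hij p rfl hqp hgt

/-- Unknowns of smaller length have smaller rank. -/
theorem rank_lt_of_lt {d d' M a a' : ℕ} (h : d' < d) : d' * (M + 1) + (M - a') <
    d * (M + 1) + (M - a) := by
  have : (d' + 1) * (M + 1) ≤ d * (M + 1) := Nat.mul_le_mul_right _ h
  rw [add_mul, one_mul] at this
  lia

/-- Unknowns of at most the same length, but further to the right, have smaller rank. -/
theorem rank_lt_of_le {d d' M a a' : ℕ} (h : d' ≤ d) (ha : a < a') (hM : a' ≤ M) :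
    d' * (M + 1) + (M - a') < d * (M + 1) + (M - a) := by
  have : d' * (M + 1) ≤ d * (M + 1) := Nat.mul_le_mul_right _ h
  lia

/-- The solutions of the equations of a stratum are parametrized by an affine space.  The equations
are triangular with respect to the length `p - q` of the unknowns and, for equal lengths, to the
position of the vertex from right to left. -/
theorem exists_parametrization [Finite I] (hpos : IsLinePosition pos)
    (hρ : ∀ {i j : I}, (i ⟶ j) → ∀ (p : A.K i) (p' : A.K j), (p' : ℤ) = p → ρ j p' ≤ ρ i p) :
    ∃ (n : ℕ) (e : Fin n → A.Var) (s : (Fin n → ℂ) → A.Var → ℂ),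
      (∀ t, IsAllowed ρ (e t).1 (e t).2.1 (e t).2.2) ∧
      (∀ v, (fun z => s z v) ∈ polyFunctions (Fin n → ℂ)) ∧ (∀ z t, s z (e t) = z t) ∧
      (∀ z, IsSolution ρ (s z)) ∧ ∀ c, IsSolution ρ c → s (fun t => c (e t)) = c := by
  classical
  obtain ⟨M, hM⟩ : ∃ M, ∀ i, pos i ≤ M := by
    obtain ⟨M, hM⟩ := (Set.finite_range pos).bddAbove
    exact ⟨M, fun i => hM ⟨i, rfl⟩⟩
  let rank : A.Var → ℕ := fun v => ((v.2.2 : ℤ) - v.2.1).toNat * (M + 1) + (M - pos v.1)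
  have hsub : ∀ {i j : I} (h h' : i ⟶ j), h = h' := fun {i j} h h' =>
    Sum.inl_injective ((hpos.subsingleton i j).elim (.inl h) (.inl h'))
  have hemp : ∀ {i j : I}, (i ⟶ j) → (j ⟶ i) → False := fun {i j} h h' =>
    Sum.inl_ne_inr ((hpos.subsingleton i j).elim (.inl h) (.inr h'))
  -- the free unknowns are the allowed ones which are not determined by any equation
  let free : Set A.Var := {v | ∀ c, IsAllowed ρ v.1 v.2.1 v.2.2 ∧ IsSolutionAt ρ c v}
  have hG : ∀ v : A.Var, ∃ G : (A.Var → ℂ) → ℂ, v ∉ free → G ∈ polyFunctions (A.Var → ℂ) ∧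
      (∀ c c' : A.Var → ℂ, (∀ w, rank w < rank v → c w = c' w) → G c = G c') ∧
      ∀ c, IsSolutionAt ρ c v ↔ c v = G c := by
    rintro ⟨i, q, p⟩
    by_cases hqp : IsAllowed ρ i q p
    swap
    · -- an unknown which is not allowed is zero, and there is no other equation
      refine ⟨fun _ => 0, fun _ => ⟨const_mem_polyFunctions 0, fun _ _ _ => rfl, fun c =>
        ⟨fun h => h.1 hqp, fun h => ⟨fun _ => h, fun j a _ q' hq' hlt hlt' => ?_,
          fun j a _ p' hp' hlt hlt' => ?_⟩⟩⟩⟩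
      · exact absurd ⟨hlt', hlt.trans_le (hρ a q q' hq')⟩ hqp
      · exact absurd ⟨hlt', (hρ a p' p hp'.symm).trans_lt hlt⟩ hqp
    have hlen : (q : ℤ) < p := hqp.1
    by_cases hR : ∃ (j : I) (_ : i ⟶ j) (q' : A.K j), pos j = pos i + 1 ∧ (q' : ℤ) = q ∧
      ρ i p < ρ j q'
    · obtain ⟨j, a, q', hij, hq', hlt⟩ := hR
      refine ⟨fun c => c ⟨i, q, p⟩ - A.arrowMatrix ρ c i j q' p, fun _ => ⟨sub_mem
        (coord_mem_polyFunctions _) (arrowMatrix_mem_polyFunctions i j q' p),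
        fun c c' hc => ?_, fun c => ?_⟩⟩
      · refine arrowMatrix_sub_congr_source hq' hqp (fun s t hst => hc _ ?_)
          (fun s t hst => hc _ ?_)
        · exact rank_lt_of_lt (by lia)
        · exact rank_lt_of_le (by lia) (by lia) (hM j)
      · rw [eq_comm, sub_eq_self]
        constructor
        · intro h
          exact h.2.1 j a hij q' hq' hlt hqp.1
        · refine fun h => ⟨fun hn => (hn hqp).elim, fun k a' hik q'' hq'' _ _ => ?_,
            fun k a' hik => ?_⟩
          · obtain rfl := hpos.eq_of_isLinked ⟨.inl a⟩ ⟨.inl a'⟩ (hij.trans hik.symm)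
            obtain rfl : q' = q'' := Subtype.ext (hq'.trans hq''.symm)
            exact h
          · obtain rfl := hpos.eq_of_isLinked ⟨.inl a⟩ ⟨.inr a'⟩ (hij.trans hik.symm)
            exact (hemp a a').elim
    by_cases hL : ∃ (j : I) (_ : j ⟶ i) (p' : A.K j), pos j = pos i + 1 ∧ (p' : ℤ) = p ∧
      ρ j p' < ρ i q
    · obtain ⟨j, a, p', hij, hp', hlt⟩ := hL
      refine ⟨fun c => c ⟨i, q, p⟩ + A.arrowMatrix ρ c j i q p', fun _ => ⟨add_mem
        (coord_mem_polyFunctions _) (arrowMatrix_mem_polyFunctions j i q p'),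
        fun c c' hc => ?_, fun c => ?_⟩⟩
      · refine arrowMatrix_add_congr_target hp' hqp (fun s t hst => hc _ ?_)
          (fun s t hst => hc _ ?_)
        · exact rank_lt_of_lt (by lia)
        · exact rank_lt_of_le (by lia) (by lia) (hM j)
      · rw [eq_comm, add_eq_left]
        constructor
        · intro h
          exact h.2.2 j a hij p' hp' hlt hqp.1
        · refine fun h => ⟨fun hn => (hn hqp).elim, fun k a' hik => ?_,
            fun k a' hik p'' hp'' _ _ => ?_⟩
          · obtain rfl := hpos.eq_of_isLinked ⟨.inr a⟩ ⟨.inl a'⟩ (hij.trans hik.symm)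
            exact (hemp a a').elim
          · obtain rfl := hpos.eq_of_isLinked ⟨.inr a⟩ ⟨.inr a'⟩ (hij.trans hik.symm)
            obtain rfl : p' = p'' := Subtype.ext (hp'.trans hp''.symm)
            exact h
    · refine ⟨fun _ => 0, fun hv => (hv fun c => ⟨hqp, fun hn => (hn hqp).elim,
        fun j a hij q' hq' hlt _ => ?_, fun j a hij p' hp' hlt _ => ?_⟩).elim⟩
      · exact (hR ⟨j, a, q', hij, hq', hlt⟩).elim
      · exact (hL ⟨j, a, p', hij, hp', hlt⟩).elim
  choose G hG using hG
  obtain ⟨n, e, s, he, hs, hse, hsol, huniq⟩ := exists_triangular_parametrization rank free G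
    (fun v hv => (hG v hv).1) (fun v hv => (hG v hv).2.1)
  refine ⟨n, e, s, fun t => (he t 0).1, hs, hse, fun z => ?_, fun c hc => huniq c fun v hv => ?_⟩
  · rw [isSolution_iff hpos hρ]
    intro v
    by_cases hv : v ∈ free
    · exact (hv _).2
    · exact ((hG v hv).2.2 _).2 (hsol z v hv)
  · exact ((hG v hv).2.2 c).1 ((isSolution_iff hpos hρ c).1 hc v)

theorem repr_map_columnVec {i j : I} (h : i ⟶ j) (u : Matrix (A.K i) (A.K i) ℂ) (p : A.K i)
    (q : A.K j) : (A.b j).repr (x i j h (columnVec (A.b i) u p)) q =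
      (A.labelMatrix i j * u) q p := by
  classical
  have h1 : ∀ a : A.K i, (A.b j).repr (x i j h (A.b i a)) q = A.labelMatrix i j q a := by
    intro a
    by_cases ha : (a : ℤ) ∈ A.K j
    · rw [A.map_of_mem h a ha, Module.Basis.repr_self, Finsupp.single_apply, labelMatrix]
      refine if_congr ⟨fun h => ?_, fun h => Subtype.ext h.symm⟩ rfl rfl
      rw [← h]
    · rw [A.map_of_notMem h a ha, map_zero, Finsupp.zero_apply, labelMatrix, if_neg]
      exact fun h => ha (h ▸ q.2)
  simp only [columnVec, map_sum, map_smul, Finsupp.finsetSum_apply, Finsupp.smul_apply, h1,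
    smul_eq_mul, Matrix.mul_apply]
  exact Finset.sum_congr rfl fun a _ => mul_comm _ _

/-- An arrow preserves the flags given by the matrices of unknowns if and only if its matrix in the
bases of their columns vanishes in the corresponding positions. -/
theorem mapsTo_columnSpan_iff {i j : I} (h : i ⟶ j) (c : A.Var → ℂ) :
    (∀ r, (columnSpan (A.b i) (unknownMatrix ρ c i) {p | ρ i p ≤ r}).map (x i j h) ≤
      columnSpan (A.b j) (unknownMatrix ρ c j) {p | ρ j p ≤ r}) ↔
    ∀ (q : A.K j) (p : A.K i), ρ i p < ρ j q → A.arrowMatrix ρ c i j q p = 0 := by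
  have h1 : ∀ (r : Fin m) (p : A.K i), x i j h (columnVec (A.b i) (unknownMatrix ρ c i) p) ∈
      columnSpan (A.b j) (unknownMatrix ρ c j) {p | ρ j p ≤ r} ↔
      ∀ q : A.K j, r < ρ j q → A.arrowMatrix ρ c i j q p = 0 := by
    intro r p
    rw [mem_columnSpan_iff (isUnitriangular_unknownMatrix c j).isUnit_det]
    have h2 : ∀ q, (unknownMatrix ρ c j)⁻¹.mulVec
        ((A.b j).repr (x i j h (columnVec (A.b i) (unknownMatrix ρ c i) p))) q =
        A.arrowMatrix ρ c i j q p := by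
      intro q
      rw [arrowMatrix, Matrix.mul_assoc, Matrix.mul_apply, Matrix.mulVec, dotProduct]
      exact Finset.sum_congr rfl fun a _ => by rw [repr_map_columnVec]
    simp only [h2, Set.mem_ofPred_eq, not_le]
  constructor
  · intro hr q p hqp
    exact (h1 (ρ i p) p).1 (hr _ ⟨_, columnVec_mem_columnSpan (Set.mem_ofPred_eq ▸ le_rfl), rfl⟩)
      q hqp
  · intro hz r
    rw [Submodule.map_le_iff_le_comap]
    refine Submodule.span_le.2 ?_
    rintro _ ⟨p, rfl⟩
    exact (h1 r p).2 fun q hq => hz q p (lt_of_le_of_lt p.2 hq)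

end AdaptedBases

end Stratum

/-! ### The strata of a fibre -/

theorem GradedFlag.monotone_sub {I : Type*} {V : I → Type*} [∀ i, AddCommGroup (V i)]
    [∀ i, Module ℂ (V i)] {ν : I → ℕ} {y : FlagType ν} (φ : GradedFlag V y) (i : I) :
    Monotone fun r => φ.sub r i :=
  Fin.monotone_iff_le_succ.2 fun r => φ.mono r i

section Fibre

variable {I : Type*} [Quiver.{v + 1} I] {pos : I → ℕ} {V : I → Type*}
  [∀ i, AddCommGroup (V i)] [∀ i, Module ℂ (V i)] {x : QuiverRep V} {ν : I → ℕ} {y : FlagType ν}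

theorem finrank_quotient_submoduleOf_eq {W : Type*} [AddCommGroup W] [Module ℂ W]
    [FiniteDimensional ℂ W] {A B A' B' : Submodule ℂ W} (h : A ≤ B) (h' : A' ≤ B')
    (hA : Module.finrank ℂ A = Module.finrank ℂ A')
    (hB : Module.finrank ℂ B = Module.finrank ℂ B') :
    Module.finrank ℂ (B ⧸ A.submoduleOf B) = Module.finrank ℂ (B' ⧸ A'.submoduleOf B') := by
  have h1 := Submodule.finrank_quotient_add_finrank (A.submoduleOf B)
  have h2 := Submodule.finrank_quotient_add_finrank (A'.submoduleOf B')
  rw [(Submodule.submoduleOfEquivOfLe h).finrank_eq] at h1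
  rw [(Submodule.submoduleOfEquivOfLe h').finrank_eq] at h2
  lia

namespace AdaptedBases

/-- The jump function of the flag `φ₀`: the label `p` at the vertex `i` is a pivot from the step
`ρ i p` on. -/
def IsJumpFunction (A : AdaptedBases pos x) (φ₀ : GradedFlag V y)
    (ρ : ∀ i, A.K i → Fin (y.length + 1)) : Prop :=
  ∀ r i p, p ∈ pivots (A.b i) (φ₀.sub r i) ↔ ρ i p ≤ r

variable {A : AdaptedBases pos x} {φ₀ : GradedFlag V y} {ρ : ∀ i, A.K i → Fin (y.length + 1)}

theorem exists_isJumpFunction (A : AdaptedBases pos x) (φ₀ : GradedFlag V y) :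
    ∃ ρ, A.IsJumpFunction φ₀ ρ := by
  have h : ∀ i (p : A.K i), ∃ r, ∀ r', p ∈ pivots (A.b i) (φ₀.sub r' i) ↔ r ≤ r' := by
    intro i p
    obtain ⟨r, hr, hmin⟩ := WellFounded.has_min (wellFounded_lt (α := Fin (y.length + 1)))
      {r | p ∈ pivots (A.b i) (φ₀.sub r i)}
      ⟨Fin.last _, by simp [φ₀.sub_last, pivots_top]⟩
    exact ⟨r, fun r' => ⟨fun h => not_lt.1 (hmin r' h),
      fun h => pivots_mono (φ₀.monotone_sub i h) hr⟩⟩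
  choose ρ hρ using h
  exact ⟨ρ, fun r i p => hρ i p r⟩

/-- An arrow preserving the flag `φ₀` maps pivots to pivots. -/
theorem IsJumpFunction.le (hρ : A.IsJumpFunction φ₀ ρ)
    (hx : ∀ r i j (h : i ⟶ j), (φ₀.sub r i).map (x i j h) ≤ φ₀.sub r j) {i j : I} (h : i ⟶ j)
    (p : A.K i) (p' : A.K j) (hp : (p' : ℤ) = p) : ρ j p' ≤ ρ i p := by
  classical
  rw [← hρ]
  obtain ⟨v, hv, hvp, hv1⟩ := (hρ _ i p).2 le_rfl
  have hrepr : ∀ q : A.K j, (A.b j).repr (x i j h v) q =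
      ∑ a : A.K i, (A.b i).repr v a * A.labelMatrix i j q a := by
    intro q
    have h1 : v = columnVec (A.b i) (Matrix.of fun a _ => (A.b i).repr v a) p :=
      eq_columnVec fun _ => rfl
    conv_lhs => rw [h1]
    rw [repr_map_columnVec, Matrix.mul_apply]
    exact Finset.sum_congr rfl fun a _ => mul_comm _ _
  refine ⟨x i j h v, hx _ i j h ⟨v, hv, rfl⟩, fun q hq => ?_, ?_⟩
  · rw [hrepr]
    refine Finset.sum_eq_zero fun a _ => ?_
    by_cases ha : (q : ℤ) = a
    · rw [hvp a (by lia), zero_mul]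
    · rw [labelMatrix, if_neg ha, mul_zero]
  · rw [hrepr, Finset.sum_eq_single p]
    · simpa [labelMatrix, hp] using hv1
    · intro a _ hap
      rw [labelMatrix, if_neg fun h => hap (Subtype.ext (h.symm.trans hp)), mul_zero]
    · simp

/-- The steps of the flag `φ` are spanned by the columns of the matrices of unknowns `c`. -/
def HasForm (ρ : ∀ i, A.K i → Fin (y.length + 1)) (c : A.Var → ℂ) (φ : GradedFlag V y) : Prop :=
  ∀ r i, φ.sub r i = columnSpan (A.b i) (unknownMatrix ρ c i) {p | ρ i p ≤ r}

/-- The flags with a given jump function which are preserved by the arrows come from the solutions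
of the equations of the stratum: the unknowns are the coefficients of reduced echelon forms. -/
theorem IsJumpFunction.exists_hasForm {φ : GradedFlag V y} (hρ : A.IsJumpFunction φ ρ)
    (hx : ∀ r i j (h : i ⟶ j), (φ.sub r i).map (x i j h) ≤ φ.sub r j) :
    ∃ c, IsSolution ρ c ∧ HasForm ρ c φ := by
  classical
  choose u hu hu0 hus using fun i => exists_unitriangular_of_pivots (φ.monotone_sub i)
    (ρ := ρ i) fun r p => hρ r i p
  let c : A.Var → ℂ := fun v => if IsAllowed ρ v.1 v.2.1 v.2.2 then u v.1 v.2.1 v.2.2 else 0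
  have hc : ∀ i, unknownMatrix ρ c i = u i := by
    intro i
    ext q p
    by_cases hqp : q = p
    · rw [hqp, (hu i).diag, (isUnitriangular_unknownMatrix c i).diag]
    · by_cases h : IsAllowed ρ i q p
      · rw [unknownMatrix_of_isAllowed h]
        exact if_pos h
      · rw [unknownMatrix, if_neg hqp, if_neg h]
        rcases lt_or_gt_of_ne hqp with hlt | hlt
        · exact (hu0 i q p hqp (not_lt.1 fun h' => h ⟨hlt, h'⟩)).symm
        · exact ((hu i).eq_zero q p hlt).symm
  have hform : HasForm ρ c φ := fun r i => by rw [hc, ← hus i r]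
  refine ⟨c, ⟨fun i q p h => if_neg h, fun i j h => ?_⟩, hform⟩
  rw [← mapsTo_columnSpan_iff h]
  intro r
  rw [← hform, ← hform]
  exact hx r i j h

theorem HasForm.isJumpFunction {c : A.Var → ℂ} {φ : GradedFlag V y} (h : HasForm ρ c φ) :
    A.IsJumpFunction φ ρ := by
  intro r i p
  rw [h, pivots_columnSpan (isUnitriangular_unknownMatrix c i)]
  rfl

theorem HasForm.eq {c : A.Var → ℂ} {φ φ' : GradedFlag V y} (h : HasForm ρ c φ)
    (h' : HasForm ρ c φ') : φ = φ' :=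
  GradedFlag.ext (funext fun r => funext fun i => (h r i).trans (h' r i).symm)

theorem IsJumpFunction.finrank_columnSpan (hρ : A.IsJumpFunction φ₀ ρ) (c : A.Var → ℂ)
    (r : Fin (y.length + 1)) (i : I) :
    Module.finrank ℂ (columnSpan (A.b i) (unknownMatrix ρ c i) {p | ρ i p ≤ r}) =
      Module.finrank ℂ (φ₀.sub r i) := by
  classical
  rw [_root_.finrank_columnSpan (isUnitriangular_unknownMatrix c i).isUnit_det,
    finrank_eq_card_pivots (b := A.b i)]
  congr 1
  ext p
  simp [hρ r i p]

/-- The flag formed by the columns of the matrices of unknowns. -/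
theorem IsJumpFunction.exists_flag (hρ : A.IsJumpFunction φ₀ ρ) (c : A.Var → ℂ) :
    ∃ φ : GradedFlag V y, HasForm ρ c φ := by
  have hfin : ∀ i, FiniteDimensional ℂ (V i) := fun i => (A.b i).finiteDimensional_of_finite
  refine ⟨⟨fun r i => columnSpan (A.b i) (unknownMatrix ρ c i) {p | ρ i p ≤ r}, fun i => ?_,
    fun i => ?_, fun r i => columnSpan_mono fun p hp =>
      le_trans hp (Fin.castSucc_lt_succ (i := r)).le, fun r i => ?_⟩, fun r i => rfl⟩
  · refine Submodule.finrank_eq_zero.1 ?_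
    rw [hρ.finrank_columnSpan, φ₀.sub_zero, finrank_bot]
  · refine Submodule.eq_top_of_finrank_eq ?_
    rw [hρ.finrank_columnSpan, φ₀.sub_last, finrank_top]
  · rw [← φ₀.finrank_quotient r i]
    exact finrank_quotient_submoduleOf_eq (columnSpan_mono fun p hp =>
      le_trans hp (Fin.castSucc_lt_succ (i := r)).le) (φ₀.mono r i)
      (hρ.finrank_columnSpan c _ i) (hρ.finrank_columnSpan c _ i)

theorem IsJumpFunction.nonempty_equiv [∀ i, FiniteDimensional ℂ (V i)] (hρ : A.IsJumpFunction φ₀ ρ)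
    (r : Fin (y.length + 1)) (i : I) :
    Nonempty (Fin (y.stepDim r i) ≃ {p : A.K i // ρ i p ≤ r}) := by
  classical
  refine ⟨Fintype.equivOfCardEq ?_⟩
  rw [Fintype.card_fin, ← φ₀.finrank_sub, finrank_eq_card_pivots (b := A.b i),
    Fintype.card_subtype]
  congr 1
  ext p
  simp [hρ r i p]

end AdaptedBases

end Fibre

/-! ### The affine cell decomposition of a fibre -/

section MainResult

variable {I : Type*} [Quiver.{v + 1} I] {pos : I → ℕ} {V : I → Type*}
  [∀ i, AddCommGroup (V i)] [∀ i, Module ℂ (V i)]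
  {x : QuiverRep V} {ν : I → ℕ} {y : FlagType ν}

open SpaceWithFunctions AdaptedBases

/-- The flag of a point of a fibre. -/
abbrev fibreFlag (p : lusztigFibre V y x) : GradedFlag V y := p.1.1.2

theorem fibreFlag_map_le (p : lusztigFibre V y x) (r : Fin (y.length + 1)) (i j : I) (h : i ⟶ j) :
    ((fibreFlag p).sub r i).map (x i j h) ≤ (fibreFlag p).sub r j := by
  have h1 : p.1.1.1 = x := p.2
  have h2 := p.1.2 r i j h
  rwa [h1] at h2

theorem fibre_ext {p p' : lusztigFibre V y x} (h : fibreFlag p = fibreFlag p') : p = p' := by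
  have h1 : p.1.1.1 = x := p.2
  have h2 : p'.1.1.1 = x := p'.2
  exact Subtype.ext (Subtype.ext (Prod.ext (h1.trans h2.symm) h))

/-- The point of a fibre given by a flag preserved by the representation. -/
def fibrePoint (φ : GradedFlag V y)
    (h : ∀ r i j (a : i ⟶ j), (φ.sub r i).map (x i j a) ≤ φ.sub r j) : lusztigFibre V y x :=
  ⟨⟨(x, φ), h⟩, rfl⟩

/-- The relative position of a flag and of the adapted bases: the dimensions of the intersections
with the coordinate flags. -/
noncomputable def relativePosition (A : AdaptedBases pos x) (φ : GradedFlag V y)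
    (t : Σ j : Fin (y.length + 1) × I, A.K j.2 × Bool) : ℕ :=
  Module.finrank ℂ (φ.sub t.1.1 t.1.2 ⊓ coordStep (A.b t.1.2)
    (if t.2.2 then (t.2.1 : ℤ) else t.2.1 - 1) : Submodule ℂ (V t.1.2))

theorem relativePosition_eq_iff (A : AdaptedBases pos x) (φ φ' : GradedFlag V y) :
    relativePosition A φ = relativePosition A φ' ↔
      ∀ r i, pivots (A.b i) (φ.sub r i) = pivots (A.b i) (φ'.sub r i) := by
  constructor
  · intro h r i
    ext p
    have h1 : Module.finrank ℂ (φ.sub r i ⊓ coordStep (A.b i) p : Submodule ℂ (V i)) =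
      Module.finrank ℂ (φ'.sub r i ⊓ coordStep (A.b i) p : Submodule ℂ (V i)) :=
      congrFun h ⟨(r, i), p, true⟩
    have h2 : Module.finrank ℂ (φ.sub r i ⊓ coordStep (A.b i) (p - 1) : Submodule ℂ (V i)) =
      Module.finrank ℂ (φ'.sub r i ⊓ coordStep (A.b i) (p - 1) : Submodule ℂ (V i)) :=
      congrFun h ⟨(r, i), p, false⟩
    rw [mem_pivots_iff, mem_pivots_iff]
    rw [h1, h2]
  · intro h
    funext ⟨⟨r, i⟩, p, ε⟩
    rw [relativePosition, relativePosition, finrank_inf_coordStep, finrank_inf_coordStep, h]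

variable [∀ i, FiniteDimensional ℂ (V i)]

theorem isMorphism_fibre :
    IsMorphism ((lusztigVariety V y).restrict (lusztigFibre V y x))
      (grassmannianProduct (QuiverRep V) (fun j : Fin (y.length + 1) × I => V j.2)
        (fun j => y.stepDim j.1 j.2)) (fun p => lusztigEmbedding V y p.1) :=
  (isMorphism_induced _ _).comp (isMorphism_induced _ _)

variable [Finite I]

theorem eventually_relativePosition_le (A : AdaptedBases pos x) (p : lusztigFibre V y x) :
    ∀ᶠ z in @nhds _ ((lusztigVariety V y).restrict (lusztigFibre V y x)).top p,
      relativePosition A (fibreFlag z) ≤ relativePosition A (fibreFlag p) := by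
  simp only [Pi.le_def]
  rw [Filter.eventually_all]
  intro t
  have h1 := eventually_finrank_inf_le (E := QuiverRep V)
    (W := fun j : Fin (y.length + 1) × I => V j.2) (k := fun j => y.stepDim j.1 j.2)
    (lusztigEmbedding V y p.1) t.1
    (coordStep (A.b t.1.2) (if t.2.2 then (t.2.1 : ℤ) else t.2.1 - 1))
  exact isMorphism_fibre.eventually h1

/-- Each stratum of a fibre is an affine space: the solutions of the equations of the stratum give
a polynomial family of frames, and the free unknowns are recovered as coordinates of charts. -/
theorem exists_iso_stratum (hpos : IsLinePosition pos) (A : AdaptedBases pos x)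
    (p₀ : lusztigFibre V y x) : ∃ n : ℕ, Nonempty (Iso
      (((lusztigVariety V y).restrict (lusztigFibre V y x)).restrict
        {p | relativePosition A (fibreFlag p) = relativePosition A (fibreFlag p₀)})
      (affine (Fin n → ℂ))) := by
  classical
  have := Fintype.ofFinite I
  obtain ⟨ρ, hρ⟩ := exists_isJumpFunction A (fibreFlag p₀)
  have hjump : ∀ φ : GradedFlag V y, A.IsJumpFunction φ ρ ↔
      relativePosition A φ = relativePosition A (fibreFlag p₀) := by
    intro φ
    rw [relativePosition_eq_iff]
    constructor
    · intro h r i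
      ext q
      rw [h r i q, hρ r i q]
    · intro h r i q
      rw [h, hρ r i q]
  obtain ⟨n, e, s, he, hs, hse, hsol, huniq⟩ := exists_parametrization hpos
    (hρ.le (fibreFlag_map_le p₀))
  choose φ hφ using fun z => hρ.exists_flag (s z)
  have hmap : ∀ z r i j (h : i ⟶ j), ((φ z).sub r i).map (x i j h) ≤ (φ z).sub r j := by
    intro z r i j h
    rw [hφ, hφ]
    exact (mapsTo_columnSpan_iff h (s z)).2 ((hsol z).2 i j h) r
  obtain ⟨ε⟩ : Nonempty (∀ j : Fin (y.length + 1) × I,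
      Fin (y.stepDim j.1 j.2) ≃ {p : A.K j.2 // ρ j.2 p ≤ j.1}) :=
    ⟨fun j => (hρ.nonempty_equiv j.1 j.2).some⟩
  let f : (Fin n → ℂ) → {p : lusztigFibre V y x |
      relativePosition A (fibreFlag p) = relativePosition A (fibreFlag p₀)} := fun z =>
    ⟨fibrePoint (φ z) (hmap z), (hjump _).1 (hφ z).isJumpFunction⟩
  -- the frames formed by the columns lift `f` to the space of frames
  let F : (Fin n → ℂ) → framedSet (QuiverRep V) (fun j : Fin (y.length + 1) × I => V j.2)
      (fun j => y.stepDim j.1 j.2) := fun z =>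
    ⟨(x, fun j t => columnVec (A.b j.2) (unknownMatrix ρ (s z) j.2) (ε j t).1), fun j =>
      (linearIndependent_columnVec (isUnitriangular_unknownMatrix _ _).isUnit_det).comp _
        (Subtype.val_injective.comp (ε j).injective)⟩
  have hF : ∀ z, framedMap _ _ _ (F z) = lusztigEmbedding V y (f z).1.1 := by
    intro z
    refine Prod.ext rfl (funext fun j => Subtype.ext ?_)
    change Submodule.span ℂ (Set.range ((fun p : {p // ρ j.2 p ≤ j.1} =>
      columnVec (A.b j.2) (unknownMatrix ρ (s z) j.2) p.1) ∘ ε j)) = (φ z).sub j.1 j.2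
    rw [(ε j).surjective.range_comp, hφ]
    rfl
  have hFm : IsMorphism (affine (Fin n → ℂ)) ((affine _).restrict (framedSet (QuiverRep V)
      (fun j : Fin (y.length + 1) × I => V j.2) (fun j => y.stepDim j.1 j.2))) F := by
    refine IsMorphism.to_induced (isMorphism_of_isPolyMap ?_)
    refine isPolyMap_prodMk (isPolyMap_const x) (isPolyMap_pi fun j => isPolyMap_pi fun t => ?_)
    refine IsPolyMap.sum _ fun q _ => isPolyMap_smul ?_ _
    exact (show IsPolyMap s from isPolyMap_pi fun v => by
      simpa using isPolyMap_smul (hs v) (1 : ℂ)).comp_mem (unknownMatrix_mem_polyFunctions _ _ _)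
  have hfm : IsMorphism (affine (Fin n → ℂ))
      (((lusztigVariety V y).restrict (lusztigFibre V y x)).restrict _) f := by
    refine IsMorphism.to_induced (IsMorphism.to_induced (IsMorphism.to_induced ?_))
    have h1 : IsMorphism (affine (Fin n → ℂ)) (grassmannianProduct (QuiverRep V)
        (fun j : Fin (y.length + 1) × I => V j.2) (fun j => y.stepDim j.1 j.2))
        (fun z => framedMap _ _ _ (F z)) := (isMorphism_quotient _ _).comp hFm
    rw [show (fun z => framedMap _ _ _ (F z)) = fun z => lusztigEmbedding V y (f z).1.1 from
      funext hF] at h1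
    exact h1
  -- the unknown `(q, p)` is a coordinate of the chart given by the pivots of the step `ρ i p`
  let chart : ∀ j : Fin (y.length + 1) × I, V j.2 →ₗ[ℂ] (Fin (y.stepDim j.1 j.2) → ℂ) := fun j =>
    LinearMap.pi fun t => (A.b j.2).coord (ε j t).1
  have hchart : ∀ p : lusztigFibre V y x,
      relativePosition A (fibreFlag p) = relativePosition A (fibreFlag p₀) →
      ∀ j, lusztigEmbedding V y p.1 ∈ chartDomain (QuiverRep V)
        (W := fun j : Fin (y.length + 1) × I => V j.2) j (chart j) := by
    intro p hp j w hw hw0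
    refine eq_zero_of_pivots (b := A.b j.2) hw fun q hq => ?_
    have h1 := congrFun hw0 ((ε j).symm ⟨q, ((hjump _).2 hp j.1 j.2 q).1 hq⟩)
    simpa [chart] using h1
  let g' : lusztigFibre V y x → Fin n → ℂ := fun p t =>
    chartCoord (QuiverRep V) (W := fun j : Fin (y.length + 1) × I => V j.2)
      (ρ (e t).1 (e t).2.2, (e t).1) (chart _)
      (fun a => if (ε (ρ (e t).1 (e t).2.2, (e t).1) a).1 = (e t).2.2 then 1 else 0)
      ((A.b (e t).1).coord (e t).2.1) (lusztigEmbedding V y p.1)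
  have hg' : ∀ (p : lusztigFibre V y x) (c : A.Var → ℂ), HasForm ρ c (fibreFlag p) →
      g' p = fun t => c (e t) := by
    intro p c hc
    funext t
    have hp := (hjump _).1 hc.isJumpFunction
    refine (chartCoord_eq (hchart p hp _)
      (w := columnVec (A.b (e t).1) (unknownMatrix ρ c (e t).1) (e t).2.2) ?_ ?_).trans ?_
    · change _ ∈ (fibreFlag p).sub _ _
      rw [hc]
      exact columnVec_mem_columnSpan (Set.mem_ofPred_eq ▸ le_rfl)
    · funext a
      simp only [chart, LinearMap.pi_apply, Module.Basis.coord_apply, repr_columnVec,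
        unknownMatrix]
      refine if_congr Iff.rfl rfl (if_neg fun h => ?_)
      exact absurd h.2 (not_lt.2 (ε (ρ (e t).1 (e t).2.2, (e t).1) a).2)
    · rw [Module.Basis.coord_apply, repr_columnVec, unknownMatrix_of_isAllowed (he t)]
  refine ⟨n, nonempty_iso_affine _ f hfm (fun p => g' p.1) (fun t p => ?_) (fun p => ?_)
    (fun z => ?_)⟩
  · have h1 := isRegularAt_chartCoord (E := QuiverRep V)
      (W := fun j : Fin (y.length + 1) × I => V j.2) (k := fun j => y.stepDim j.1 j.2)
      (ρ (e t).1 (e t).2.2, (e t).1) (chart _)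
      (fun a => if (ε (ρ (e t).1 (e t).2.2, (e t).1) a).1 = (e t).2.2 then 1 else 0)
      ((A.b (e t).1).coord (e t).2.1) (hchart p.1 p.2 _)
    exact (isMorphism_fibre.comp (isMorphism_induced _ Subtype.val)).2 p _ h1
  · obtain ⟨c, hc, hcp⟩ := IsJumpFunction.exists_hasForm ((hjump _).2 p.2)
      (fibreFlag_map_le p.1)
    refine Subtype.ext (fibre_ext ?_)
    have h1 : HasForm ρ (s (g' p.1)) (fibreFlag (f (g' p.1)).1) := hφ _
    rw [hg' p.1 c hcp, huniq c hc] at h1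
    rw [hg' p.1 c hcp]
    exact h1.eq hcp
  · rw [hg' (f z).1 (s z) (hφ z)]
    exact funext fun t => hse z t

end MainResult

theorem mainTheorem10 {I : Type u} [Finite I] [Quiver.{v + 1} I] (hI : IsQuiverOfTypeA I)
    (ν : I → ℕ) (V : I → Type w) [∀ i, AddCommGroup (V i)] [∀ i, Module ℂ (V i)]
    [∀ i, FiniteDimensional ℂ (V i)] (hV : ∀ i, Module.finrank ℂ (V i) = ν i)
    (y : FlagType ν) (x : QuiverRep V) :
    lusztigFibre V y x = ∅ ∨
      ((lusztigVariety V y).restrict (lusztigFibre V y x)).HasAffineCellDecomposition := by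
  right
  obtain ⟨pos, hpos⟩ := hI.exists_isLinePosition
  obtain ⟨A⟩ := nonempty_adaptedBases hpos x
  exact SpaceWithFunctions.hasAffineCellDecomposition_of_semicontinuous _
    (fun p => relativePosition A (fibreFlag p)) (fun t => Module.finrank ℂ (V t.1.2))
    (fun p t => Submodule.finrank_le _) (eventually_relativePosition_le A)
    (exists_iso_stratum hpos A)
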